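/- Let $\theta=(\theta_1,\dots,\theta_K)$ with $\theta_k=(\mu_k,\sigma_k^2)$, $\sigma_k^2>0$, and let the rewards $X_{k1},X_{k2},\dots$ of arm $k$ be i.i.d. $N(\mu_k,\sigma_k^2)$, independently over the arms $k=1,\dots,K$. Put $\mu_*=\max_k\mu_k$, $M(z)=\tfrac12\log(1+z^2)$, $$r(\theta)=\sum_{k:\mu_k<\mu_*}\frac{\mu_*-\mu_k}{M\big((\mu_*-\mu_k)/\sigma_k\big)},\qquad \widetilde R_N(\theta)=\sum_{k=1}^K(\mu_*-\mu_k)\,E_\theta (N_k-1)^+,$$ where $N_k$ is the number of rewards from arm $k$ among the first $N$ rewards. For $\Delta>0$ let $\Theta_2(\Delta)$ be the set of all $\theta$ with $\mu_k\le\mu_*-\Delta$ whenever $\mu_k<\mu_*$, $|\mu_k|\le\Delta^{-1}$ and $\Delta\le\sigma_k\le\Delta^{-1}$ for all $k$, and $\#\{k:\mu_k<\mu_*\}\ge\Delta K$. UCB-Large with confidence coefficients $(b_{nK})_{n\ge K}$ takes one reward from each arm and then, for $n=K,\dots,N-1$, when there are $n$ rewards of which $n_k$ are from arm $k$, takes the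 next reward from an arm with the largest value of $$U_k^n=\bar X_{kn_k}+\hat\sigma_{kn_k}\sqrt{\exp\Big(\frac{2b_{nK}}{n_k-1}\Big)-1}\qquad(U_k^n=+\infty\text{ if }n_k=1),$$ where $\bar X_{ks}=s^{-1}\sum_{t\le s}X_{kt}$ and $\hat\sigma_{ks}^2=s^{-1}\sum_{t\le s}(X_{kt}-\bar X_{ks})^2$; ties are broken by any measurable rule depending on the past. Let $(\Delta_K)$ be positive numbers with $\Delta_K\to0$ and $\Delta_KK^\epsilon\to\infty$ as $K\to\infty$ for every $\epsilon>0$. (a) Let $K=K_N=N^{\zeta+o(1)}$ as $N\to\infty$ with $0<\zeta<1$, let $q>0$, and let $b_{nK}=\log(n/K^{1-q})$. Then $$\limsup_{N\to\infty}\ \sup_{\theta\in\Theta_2(\Delta_K)}\frac{\widetilde R_N(\theta)}{r(\theta)\log N}\le 1-\zeta+\zeta q.$$ (b) Let $K$ be fixed, let $\alpha>1$, and let $b_{nK}=b_{n/K}$ with $b_m=\log m+\alpha\log(1+\log m)$. Then $$\limsup_{N\to\infty}\ \sup_{\theta\in\Theta_2(\Delta_K)}\frac{\widetilde R_N(\theta)}{r(\theta)\log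 N}\le 1$$ (the same bound with $\zeta=0$). -/

import Mathlib

open MeasureTheory ProbabilityTheory Filter Topology
open scoped NNReal ENNReal

noncomputable section

namespace UCBLarge

/-! ### Bandit algorithms and their runs -/

/-- What has been observed after `n` rewards: the arm sampled at each step, and the reward. -/
abbrev History (K n : ℕ) : Type := Fin n → Fin K × ℝ

/-- A bandit algorithm for `K` arms: after `n` rewards it selects the next arm as a (measurable)
function of the past. -/
structure Policy (K : ℕ) where
  act : (n : ℕ) → History K n → Fin K
  measurable_act : ∀ n, Measurable (act n)

/-- `n_k`: the number of rewards from arm `k`. -/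
def count {K n : ℕ} (h : History K n) (k : Fin K) : ℕ :=
  (Finset.univ.filter fun i => (h i).1 = k).card

/-- The sample mean of the rewards from arm `k`. -/
def sampleMean {K n : ℕ} (h : History K n) (k : Fin K) : ℝ :=
  (∑ i ∈ Finset.univ.filter (fun i => (h i).1 = k), (h i).2) / (count h k : ℝ)

/-- The sample variance (normalized by the number of rewards) of the rewards from arm `k`. -/
def sampleVar {K n : ℕ} (h : History K n) (k : Fin K) : ℝ :=
  (∑ i ∈ Finset.univ.filter (fun i => (h i).1 = k), ((h i).2 - sampleMean h k) ^ 2) /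
    (count h k : ℝ)

/-- The history produced by a policy from a reward table `ω`, where `ω (k, t)` is the
`(t + 1)`-st reward of arm `k`. -/
def history {K : ℕ} (π : Policy K) (ω : Fin K × ℕ → ℝ) : (n : ℕ) → History K n
  | 0 => Fin.elim0
  | n + 1 =>
    let h := history π ω n
    let k := π.act n h
    Fin.snoc (α := fun _ => Fin K × ℝ) h (k, ω (k, count h k))

/-! ### The UCB-Large algorithm for normal rewards with unknown variances -/

/-- The upper confidence bound of arm `k` with confidence coefficient `b`,
`X̄ + σ̂ √(exp (2 b / (n_k - 1)) - 1)`. With at most one reward from the arm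
(division by `n_k - 1 = 0`) the upper confidence bound is `+∞`. -/
def ucb {K n : ℕ} (b : ℝ) (h : History K n) (k : Fin K) : EReal :=
  if count h k ≤ 1 then ⊤
  else ((sampleMean h k +
    √(sampleVar h k) * √(Real.exp (2 * b / ((count h k : ℝ) - 1)) - 1) : ℝ) : EReal)

/-- `π` is a UCB-Large algorithm with confidence coefficient `b n` at sample size `n`: the first
`K` samples are one from each arm, in any order, and each later sample is from an arm with largest
upper confidence bound, ties being broken in any (measurable) way. -/
structure IsUCB {K : ℕ} (b : ℕ → ℝ) (π : Policy K) : Prop where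
  init : ∀ n < K, ∀ h : History K n, count h (π.act n h) = 0
  maximal : ∀ n ≥ K, ∀ h : History K n, ∀ k, ucb (b n) h k ≤ ucb (b n) h (π.act n h)

/-- The confidence coefficient `log (n / K ^ (1 - q))`, for a growing number `K` of arms. -/
def coeffLarge (q : ℝ) (K n : ℕ) : ℝ := Real.log ((n : ℝ) / (K : ℝ) ^ (1 - q))

/-- The function `b_m = log m + α log (1 + log m)`. -/
def bFixed (α m : ℝ) : ℝ := Real.log m + α * Real.log (1 + Real.log m)

/-- The confidence coefficient `b_{n/K}`, for a fixed number `K` of arms. -/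
def coeffFixed (α : ℝ) (K n : ℕ) : ℝ := bFixed α ((n : ℝ) / (K : ℝ))

/-! ### The normal model; a parameter is `θ k = (μ_k, σ_k ^ 2)` -/

/-- The parameters of `K` normal arms. -/
abbrev Params (K : ℕ) : Type := Fin K → ℝ × ℝ≥0

/-- The mean `μ_k`. -/
def mean {K : ℕ} (θ : Params K) (k : Fin K) : ℝ := (θ k).1

/-- The standard deviation `σ_k`. -/
def sd {K : ℕ} (θ : Params K) (k : Fin K) : ℝ := √((θ k).2 : ℝ)

/-- The largest mean `μ_*`. -/
def best {K : ℕ} (θ : Params K) : ℝ := ⨆ k, mean θ k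

/-- The set of inferior arms. -/
def inferior {K : ℕ} (θ : Params K) : Finset (Fin K) :=
  Finset.univ.filter fun k => mean θ k < best θ

/-- The law of the reward table: independent rewards, those of arm `k` being `N(μ_k, σ_k ^ 2)`. -/
def rewardLaw {K : ℕ} (θ : Params K) : Measure (Fin K × ℕ → ℝ) :=
  Measure.infinitePi fun p : Fin K × ℕ => gaussianReal (θ p.1).1 (θ p.1).2

/-- The regret after `N` samples, ignoring the initial reward from each arm:
`∑ k, (μ_* - μ_k) E_θ (N_k - 1)⁺`. -/
def tildeRegret {K : ℕ} (π : Policy K) (θ : Params K) (N : ℕ) : ℝ :=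
  ∑ k, (best θ - mean θ k) *
    ∫ ω, max ((count (history π ω N) k : ℝ) - 1) 0 ∂(rewardLaw θ)

/-- `M z = (1/2) log (1 + z ^ 2)`. -/
def M (z : ℝ) : ℝ := 1 / 2 * Real.log (1 + z ^ 2)

/-- `r(θ) = ∑ (μ_* - μ_k) / M ((μ_* - μ_k) / σ_k)` over the inferior arms. -/
def r {K : ℕ} (θ : Params K) : ℝ :=
  ∑ k ∈ inferior θ, (best θ - mean θ k) / M ((best θ - mean θ k) / sd θ k)

/-- The parameter set `Θ₂(Δ)` for `K` arms. -/
def Theta2 (K : ℕ) (Δ : ℝ) : Set (Params K) :=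
  {θ | (∀ k, mean θ k < best θ → mean θ k ≤ best θ - Δ) ∧
    (∀ k, |mean θ k| ≤ Δ⁻¹) ∧
    (∀ k, Δ ≤ sd θ k ∧ sd θ k ≤ Δ⁻¹) ∧
    Δ * (K : ℝ) ≤ ((inferior θ).card : ℝ)}

/-- `Δ_K → 0` at a sub-polynomial rate. -/
structure SubPolynomial (Δ : ℕ → ℝ) : Prop where
  pos : ∀ K, 0 < Δ K
  tendsto_zero : Tendsto Δ atTop (𝓝 0)
  rate : ∀ ε : ℝ, 0 < ε → Tendsto (fun K : ℕ => Δ K * (K : ℝ) ^ ε) atTop atTop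

/-- `K = N ^ (ζ + o(1))` as `N → ∞`. -/
def ArmGrowth (K : ℕ → ℕ) (ζ : ℝ) : Prop :=
  ∃ e : ℕ → ℝ, Tendsto e atTop (𝓝 0) ∧ ∀ᶠ N : ℕ in atTop, (K N : ℝ) = (N : ℝ) ^ (ζ + e N)

/-- `sup` over `θ ∈ Θ₂(Δ)` of the ratio of the regret to `r(θ) log N`, as an extended real. -/
def worstRatio {K : ℕ} (π : Policy K) (Δ : ℝ) (N : ℕ) : EReal :=
  ⨆ θ ∈ Theta2 K Δ, ((tildeRegret π θ N / (r θ * Real.log (N : ℝ)) : ℝ) : EReal)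

end UCBLarge

end

/-!
The proof charges each sampling of an inferior arm either to the optimal arm or to the arm itself.

Fix an optimal arm with mean `μ_*` and a small `ε`, and call the upper confidence bound of the
optimal arm low if it is below `μ_* - ε Δ`. If it is not low at a step, then an arm sampled at
that step has a bound of at least `μ_* - ε Δ`, and for a given arm this happens at most once per
sample size of the arm (`count_sub_one_le`, `tildeRegret_le_sum_measureReal`). For an inferior arm
at distance `d` from `μ_*`, the bound with coefficient `b_N` is that high only while the sample
size is at most `b_N / ((1 - O(ε)) M (d / σ)) + 1`, up to large deviations of the sample mean and
variance (`sum_measureReal_highEvent_le`). Weighted with the gaps, this gives the main term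
`r(θ) b_N`.

The low events cost at most `2 / Δ` times the sum of their probabilities over the steps. After
standardization the event at sample size `s` says that `m + √V y ≤ -δ` with
`1 + y² ≥ exp (2 b / (s - 1))`, which entails `m² - y² V ≥ δ²`. Chernoff's bound for this
quadratic form has critical value `(1 + y²) ^ (-(s - 1) / 2) ≤ exp (-b)` and needs no distribution
theory: the square `m²` is linearized by an auxiliary standard normal variable, and the rest is a
product (`IsStdNormalSeq.lintegral_exp_mean_sq_sub_var`, `IsStdNormalSeq.measureReal_ucb_le`). The
loss is polynomial in `s` and in `1 / Δ`, and the margin `δ` makes the sum over `s` converge.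

Since `r(θ) ≥ Δ⁴ K` on `Θ₂(Δ)`, the low events are negligible once
`∑ exp (-b_n) = o(Δ¹³ K log N)`. For growing `K` the sum is of order `K ^ (1 - q) log N`; for
fixed `K` the summands are `o(1 / n)`. What remains is `lim b_N / log N`.
-/

noncomputable section

namespace UCBLarge

section

/-! ### Exponential moments and tail bounds for standard normal samples -/

/-- Completing the square turns the integrand into a multiple of another Gaussian density. -/
theorem lintegral_exp_quadratic_gaussianReal (u : ℝ) {c : ℝ} (hc : 0 < 1 + 2 * c) :
    ∫⁻ x, ENNReal.ofReal (Real.exp (u * x - c * x ^ 2)) ∂(gaussianReal 0 1) =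
      ENNReal.ofReal ((√(1 + 2 * c))⁻¹ * Real.exp (u ^ 2 / (2 * (1 + 2 * c)))) := by
  set A : ℝ := 1 + 2 * c with hA
  let v : ℝ≥0 := ⟨A⁻¹, by positivity⟩
  have hv : v ≠ 0 := by
    intro h
    have : (v : ℝ) = 0 := by rw [h]; rfl
    exact (inv_pos.2 hc).ne' this
  have hvc : (v : ℝ) = A⁻¹ := rfl
  rw [gaussianReal_of_var_ne_zero _ one_ne_zero,
    lintegral_withDensity_eq_lintegral_mul _ (measurable_gaussianPDF 0 1) (by fun_prop)]
  have hpt : ∀ x : ℝ, (gaussianPDF 0 1 * fun x => ENNReal.ofReal (Real.exp (u * x - c * x ^ 2))) x =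
      ENNReal.ofReal ((√A)⁻¹ * Real.exp (u ^ 2 / (2 * A))) *
        ENNReal.ofReal (gaussianPDFReal (u / A) v x) := by
    intro x
    rw [Pi.mul_apply, gaussianPDF, ← ENNReal.ofReal_mul (gaussianPDFReal_nonneg _ _ _),
      ← ENNReal.ofReal_mul (by positivity)]
    congr 1
    rw [gaussianPDFReal, gaussianPDFReal, hvc]
    have h1 : √(2 * Real.pi * A⁻¹) = √(2 * Real.pi) * (√A)⁻¹ := by
      rw [Real.sqrt_mul (by positivity), Real.sqrt_inv]
    have h2 : √A ≠ 0 := (Real.sqrt_pos.2 hc).ne'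
    have h3 : √(2 * Real.pi) ≠ 0 := (Real.sqrt_pos.2 (by positivity)).ne'
    rw [h1]
    have h4 : (√A)⁻¹ * Real.exp (u ^ 2 / (2 * A)) *
        ((√(2 * Real.pi) * (√A)⁻¹)⁻¹ * Real.exp (-(x - u / A) ^ 2 / (2 * A⁻¹))) =
        (√(2 * Real.pi))⁻¹ *
          (Real.exp (u ^ 2 / (2 * A)) * Real.exp (-(x - u / A) ^ 2 / (2 * A⁻¹))) := by
      field_simp
    rw [h4, NNReal.coe_one, mul_one, mul_assoc, ← Real.exp_add, ← Real.exp_add]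
    congr 2
    have : c = (A - 1) / 2 := by rw [hA]; ring
    rw [this]
    field_simp
    ring
  simp_rw [hpt]
  rw [lintegral_const_mul' _ _ ENNReal.ofReal_ne_top, lintegral_gaussianPDFReal_eq_one _ hv, mul_one]

variable {Ω : Type*} [MeasurableSpace Ω] {P : Measure Ω}

/-- Markov's inequality, as it is used for Chernoff bounds. -/
theorem measureReal_le_of_one_le {S : Set Ω} {f : Ω → ℝ} {C : ℝ}
    (hC : 0 ≤ C) (hf : Measurable f) (h1 : ∀ ω ∈ S, 1 ≤ f ω)
    (h2 : ∫⁻ ω, ENNReal.ofReal (f ω) ∂P ≤ ENNReal.ofReal C) : P.real S ≤ C := by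
  refine ENNReal.toReal_le_of_le_ofReal hC ?_
  calc P S ≤ P {ω | 1 ≤ ENNReal.ofReal (f ω)} :=
        measure_mono fun ω hω => by simpa using h1 ω hω
    _ = 1 * P {ω | 1 ≤ ENNReal.ofReal (f ω)} := (one_mul _).symm
    _ ≤ ∫⁻ ω, ENNReal.ofReal (f ω) ∂P := mul_meas_ge_le_lintegral hf.ennreal_ofReal 1
    _ ≤ _ := h2

/-- `Y` is a sequence of independent standard normal random variables. -/
structure IsStdNormalSeq (Y : ℕ → Ω → ℝ) (P : Measure Ω) : Prop where
  indep : iIndepFun Y P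
  meas : ∀ i, Measurable (Y i)
  law : ∀ i, P.map (Y i) = gaussianReal 0 1

variable {Y : ℕ → Ω → ℝ}

theorem IsStdNormalSeq.lintegral_exp_sum (hY : IsStdNormalSeq Y P) (s : ℕ) (u : ℝ) {c : ℝ}
    (hc : 0 < 1 + 2 * c) :
    ∫⁻ ω, ENNReal.ofReal (Real.exp (u * (∑ i ∈ Finset.range s, Y i ω) -
        c * ∑ i ∈ Finset.range s, Y i ω ^ 2)) ∂P =
      ENNReal.ofReal (((√(1 + 2 * c))⁻¹ * Real.exp (u ^ 2 / (2 * (1 + 2 * c)))) ^ s) := by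
  have h1 : ∀ ω, ENNReal.ofReal (Real.exp (u * (∑ i ∈ Finset.range s, Y i ω) -
        c * ∑ i ∈ Finset.range s, Y i ω ^ 2)) =
      ∏ i ∈ Finset.range s, (fun x => ENNReal.ofReal (Real.exp (u * x - c * x ^ 2))) (Y i ω) := by
    intro ω
    rw [← ENNReal.ofReal_prod_of_nonneg (fun _ _ => (Real.exp_pos _).le), ← Real.exp_sum,
      Finset.sum_sub_distrib, Finset.mul_sum, Finset.mul_sum]
  have hg : Measurable fun x : ℝ => ENNReal.ofReal (Real.exp (u * x - c * x ^ 2)) := by fun_prop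
  simp_rw [h1]
  rw [lintegral_prod_eq_prod_lintegral_of_indepFun (Finset.range s)
    (fun i ω => (fun x => ENNReal.ofReal (Real.exp (u * x - c * x ^ 2))) (Y i ω))
    (hY.indep.comp (fun _ => _) fun _ => hg) (fun i => hg.comp (hY.meas i))]
  have h2 : ∀ i, ∫⁻ ω, ENNReal.ofReal (Real.exp (u * Y i ω - c * Y i ω ^ 2)) ∂P =
      ENNReal.ofReal ((√(1 + 2 * c))⁻¹ * Real.exp (u ^ 2 / (2 * (1 + 2 * c)))) := by
    intro i
    rw [← lintegral_exp_quadratic_gaussianReal u hc, ← hY.law i, lintegral_map hg (hY.meas i)]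
  simp_rw [h2]
  rw [Finset.prod_const, Finset.card_range, ENNReal.ofReal_pow (by positivity)]

theorem IsStdNormalSeq.measureReal_sum_ge_le (hY : IsStdNormalSeq Y P) (s : ℕ) {a : ℝ}
    (ha : 0 ≤ a) :
    P.real {ω | a * s ≤ ∑ i ∈ Finset.range s, Y i ω} ≤ Real.exp (-(a ^ 2 / 2 * s)) := by
  have hm := hY.meas
  refine measureReal_le_of_one_le (Real.exp_pos _).le
    (f := fun ω => Real.exp (-(a ^ 2 * s)) * Real.exp (a * (∑ i ∈ Finset.range s, Y i ω) -
        0 * ∑ i ∈ Finset.range s, Y i ω ^ 2)) (by fun_prop) (fun ω hω => ?_) ?_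
  · rw [← Real.exp_add]
    refine Real.one_le_exp ?_
    have : a * (a * s) ≤ a * ∑ i ∈ Finset.range s, Y i ω := mul_le_mul_of_nonneg_left hω ha
    linarith
  · simp_rw [ENNReal.ofReal_mul (Real.exp_pos (-(a ^ 2 * s))).le]
    rw [lintegral_const_mul' _ _ ENNReal.ofReal_ne_top, hY.lintegral_exp_sum s a (by norm_num),
      ← ENNReal.ofReal_mul (Real.exp_pos _).le]
    refine ENNReal.ofReal_le_ofReal (le_of_eq ?_)
    rw [mul_zero, add_zero, Real.sqrt_one, inv_one, one_mul, ← Real.exp_nat_mul, ← Real.exp_add]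
    congr 1
    ring

theorem IsStdNormalSeq.measureReal_sum_sq_ge_le (hY : IsStdNormalSeq Y P) (s : ℕ) {ε : ℝ}
    (hε : 0 < ε) :
    P.real {ω | (1 + ε) * s ≤ ∑ i ∈ Finset.range s, Y i ω ^ 2} ≤
      Real.exp (-((ε - Real.log (1 + ε)) / 2 * s)) := by
  have hm := hY.meas
  have he : 0 < 1 + ε := by linarith
  -- The exponent `ε / (2 (1 + ε))` is optimal in Chernoff's bound for `∑ Y_i²`.
  set c : ℝ := -(ε / (2 * (1 + ε))) with hc
  have hA : 1 + 2 * c = (1 + ε)⁻¹ := by rw [hc]; field_simp; ring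
  have hcpos : 0 < ε / (2 * (1 + ε)) := by positivity
  refine measureReal_le_of_one_le (Real.exp_pos _).le
    (f := fun ω => Real.exp (-(ε / 2 * s)) * Real.exp (0 * (∑ i ∈ Finset.range s, Y i ω) -
        c * ∑ i ∈ Finset.range s, Y i ω ^ 2)) (by fun_prop) (fun ω hω => ?_) ?_
  · rw [← Real.exp_add]
    refine Real.one_le_exp ?_
    have h1 := mul_le_mul_of_nonneg_left (show (1 + ε) * s ≤ _ from hω) hcpos.le
    have h2 : ε / (2 * (1 + ε)) * ((1 + ε) * s) = ε / 2 * s := by field_simp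
    rw [h2] at h1
    rw [hc]
    linarith
  · simp_rw [ENNReal.ofReal_mul (Real.exp_pos (-(ε / 2 * s))).le]
    rw [lintegral_const_mul' _ _ ENNReal.ofReal_ne_top,
      hY.lintegral_exp_sum s 0 (by rw [hA]; positivity), ← ENNReal.ofReal_mul (Real.exp_pos _).le]
    refine ENNReal.ofReal_le_ofReal (le_of_eq ?_)
    have hs : (√(1 + 2 * c))⁻¹ = Real.exp (Real.log (1 + ε) / 2) := by
      rw [hA, Real.sqrt_inv, inv_inv, Real.exp_half, Real.exp_log he]
    rw [hs, ← Real.exp_add, ← Real.exp_nat_mul, ← Real.exp_add]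
    congr 1
    ring

/-- The exponential moment of `s (t m² - c V)`, with `m` and `V` the mean and the variance of
a sample of size `s = n + 1`, at `t = (1 - 1 / s) / 2`. The square of the sum is linearized by
`exp (z² / 2) = E exp (G z)` for an independent standard normal `G`, which leaves a product. -/
theorem IsStdNormalSeq.lintegral_exp_mean_sq_sub_var (hY : IsStdNormalSeq Y P) (n : ℕ)
    {c : ℝ} (hc : 0 ≤ c) :
    ∫⁻ ω, ENNReal.ofReal (Real.exp (((n : ℝ) / (2 * (n + 1)) + c) *
        (∑ i ∈ Finset.range (n + 1), Y i ω) ^ 2 / (n + 1) -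
          c * ∑ i ∈ Finset.range (n + 1), Y i ω ^ 2)) ∂P =
      ENNReal.ofReal (√(n + 1) * ((√(1 + 2 * c))⁻¹) ^ n) := by
  have hm := hY.meas
  have := hY.indep.isProbabilityMeasure
  have hn : (0 : ℝ) < n + 1 := by positivity
  have hA : 0 < 1 + 2 * c := by linarith
  set a : ℝ := (n : ℝ) / (2 * (n + 1)) + c with ha
  have ha0 : 0 ≤ a := by positivity
  set l : ℝ := √(2 * a / (n + 1)) with hl
  have hl2 : l ^ 2 = 2 * a / (n + 1) := Real.sq_sqrt (by positivity)
  have h1 : ∀ ω, ENNReal.ofReal (Real.exp (a *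
        (∑ i ∈ Finset.range (n + 1), Y i ω) ^ 2 / (n + 1) -
          c * ∑ i ∈ Finset.range (n + 1), Y i ω ^ 2)) =
      ∫⁻ g, ENNReal.ofReal (Real.exp ((l * g) * (∑ i ∈ Finset.range (n + 1), Y i ω) -
          c * ∑ i ∈ Finset.range (n + 1), Y i ω ^ 2)) ∂(gaussianReal 0 1) := by
    intro ω
    set S := ∑ i ∈ Finset.range (n + 1), Y i ω
    set Q := ∑ i ∈ Finset.range (n + 1), Y i ω ^ 2
    have h2 : ∀ g : ℝ, ENNReal.ofReal (Real.exp ((l * g) * S - c * Q)) =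
        ENNReal.ofReal (Real.exp (-(c * Q))) *
          ENNReal.ofReal (Real.exp ((l * S) * g - 0 * g ^ 2)) := by
      intro g
      rw [← ENNReal.ofReal_mul (Real.exp_pos _).le, ← Real.exp_add]
      congr 2
      ring
    simp_rw [h2]
    rw [lintegral_const_mul' _ _ ENNReal.ofReal_ne_top,
      lintegral_exp_quadratic_gaussianReal _ (by norm_num), ← ENNReal.ofReal_mul (Real.exp_pos _).le]
    congr 1
    rw [mul_zero, add_zero, Real.sqrt_one, inv_one, one_mul, ← Real.exp_add, mul_pow, hl2]
    congr 1
    field_simp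
    ring
  simp_rw [h1]
  rw [lintegral_lintegral_swap (by
    refine Measurable.aemeasurable ?_
    simp only [Function.uncurry_def]
    fun_prop)]
  simp_rw [hY.lintegral_exp_sum (n + 1) _ hA]
  have h3 : ∀ g : ℝ, ENNReal.ofReal (((√(1 + 2 * c))⁻¹ *
      Real.exp ((l * g) ^ 2 / (2 * (1 + 2 * c)))) ^ (n + 1)) =
      ENNReal.ofReal (((√(1 + 2 * c))⁻¹) ^ (n + 1)) *
        ENNReal.ofReal (Real.exp (0 * g - (-(a / (1 + 2 * c))) * g ^ 2)) := by
    intro g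
    rw [← ENNReal.ofReal_mul (by positivity), mul_pow, ← Real.exp_nat_mul, mul_pow, hl2]
    congr 3
    push_cast
    field_simp
    ring
  have h4 : 1 + 2 * (-(a / (1 + 2 * c))) = ((n + 1) * (1 + 2 * c))⁻¹ := by
    rw [ha]; field_simp; ring
  simp_rw [h3]
  rw [lintegral_const_mul' _ _ ENNReal.ofReal_ne_top,
    lintegral_exp_quadratic_gaussianReal _ (by rw [h4]; positivity),
    ← ENNReal.ofReal_mul (by positivity), h4]
  congr 1
  have h5 : √(1 + 2 * c) ≠ 0 := (Real.sqrt_pos.2 hA).ne'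
  rw [Real.sqrt_inv, inv_inv, Real.sqrt_mul hn.le, pow_succ]
  field_simp
  simp

/-- The factor lost by stopping short of the critical exponent is `(1 + 1 / n) ^ (n / 2) ≤ √e`. -/
theorem inv_sqrt_pow_le {n : ℕ} (hn : 1 ≤ n) {b A : ℝ}
    (hA : (n : ℝ) / (n + 1) * Real.exp (2 * b / n) ≤ A) :
    ((√A)⁻¹) ^ n ≤ 2 * Real.exp (-b) := by
  have hn0 : (0 : ℝ) < n := by exact_mod_cast hn
  have hApos : 0 < A := lt_of_lt_of_le (by positivity) hA
  have h1 : Real.exp (-1) * Real.exp (2 * b) ≤ A ^ n := by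
    refine le_trans ?_ (pow_le_pow_left₀ (by positivity) hA n)
    rw [mul_pow, ← Real.exp_nat_mul, mul_div_cancel₀ _ hn0.ne']
    refine mul_le_mul_of_nonneg_right ?_ (Real.exp_pos _).le
    have h2 : ((n : ℝ) / (n + 1)) = ((1 / n : ℝ) + 1)⁻¹ := by field_simp; ring
    rw [h2, inv_pow, Real.exp_neg]
    refine inv_anti₀ (by positivity) ?_
    calc ((1 / n : ℝ) + 1) ^ n ≤ (Real.exp (1 / n)) ^ n :=
          pow_le_pow_left₀ (by positivity) (Real.add_one_le_exp _) n
      _ = Real.exp 1 := by rw [← Real.exp_nat_mul]; congr 1; field_simp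
  have h3 : Real.exp (b - 1 / 2) ≤ (√A) ^ n := by
    refine le_of_sq_le_sq ?_ (by positivity)
    rw [← pow_mul, mul_comm n 2, pow_mul, Real.sq_sqrt hApos.le, ← Real.exp_nat_mul]
    refine le_trans (le_of_eq ?_) h1
    rw [← Real.exp_add]
    congr 1
    push_cast
    ring
  rw [inv_pow]
  calc ((√A) ^ n)⁻¹ ≤ (Real.exp (b - 1 / 2))⁻¹ := inv_anti₀ (Real.exp_pos _) h3
    _ = Real.exp (1 / 2) * Real.exp (-b) := by rw [← Real.exp_neg, ← Real.exp_add]; congr 1; ring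
    _ ≤ 2 * Real.exp (-b) := by
        refine mul_le_mul_of_nonneg_right ?_ (Real.exp_pos _).le
        rw [Real.exp_half]
        refine Real.sqrt_le_iff.2 ⟨by norm_num, ?_⟩
        linarith [Real.exp_one_lt_d9]

/-- The upper confidence bound falls below the true mean by `δ` with probability of order
`exp (-b)`, up to factors that depend on the sample size `n + 1`. This is Chernoff's bound for
`m² - y² V ≥ δ²`, where `1 + y² ≥ exp (2 b / n)`, with the exponent close to its critical value. -/
theorem IsStdNormalSeq.measureReal_ucb_le (hY : IsStdNormalSeq Y P) {n : ℕ} (hn : 1 ≤ n) (b : ℝ)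
    {δ : ℝ} (hδ : 0 ≤ δ) (m V : Ω → ℝ)
    (hm : ∀ ω, m ω = (∑ i ∈ Finset.range (n + 1), Y i ω) / (n + 1))
    (hV : ∀ ω, V ω = (∑ i ∈ Finset.range (n + 1), Y i ω ^ 2) / (n + 1) - m ω ^ 2)
    (hV0 : ∀ ω, 0 ≤ V ω) :
    P.real {ω | m ω + √(V ω) * √(Real.exp (2 * b / n) - 1) ≤ -δ} ≤
      2 * (n + 1) * Real.exp (-b) * Real.exp (-(δ ^ 2 / 4 * (n + 1))) := by
  have hmeas := hY.meas
  have hn0 : (1 : ℝ) ≤ n := by exact_mod_cast hn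
  set y : ℝ := √(Real.exp (2 * b / n) - 1) with hy
  have hy0 : 0 ≤ y := Real.sqrt_nonneg _
  have hy2 : Real.exp (2 * b / n) ≤ 1 + y ^ 2 := by
    rcases le_total 0 (Real.exp (2 * b / n) - 1) with h | h
    · rw [hy, Real.sq_sqrt h]; linarith
    · nlinarith [sq_nonneg y]
  set t : ℝ := (n : ℝ) / (2 * (n + 1)) with ht
  have ht4 : 1 / 4 ≤ t := by rw [ht, div_le_div_iff₀ (by norm_num) (by positivity)]; linarith
  set c : ℝ := t * y ^ 2 with hc
  have hc0 : 0 ≤ c := by positivity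
  have hA : (n : ℝ) / (n + 1) * Real.exp (2 * b / n) ≤ 1 + 2 * c := by
    have e : (n : ℝ) / (n + 1) = 2 * t := by rw [ht]; field_simp
    have e2 : 2 * t ≤ 1 := by rw [← e, div_le_one (by positivity)]; linarith
    rw [e, hc]
    have := mul_le_mul_of_nonneg_left hy2 (show 0 ≤ 2 * t by linarith)
    nlinarith
  refine measureReal_le_of_one_le (by positivity)
    (f := fun ω => Real.exp (-(t * δ ^ 2 * (n + 1))) * Real.exp ((t + c) *
        (∑ i ∈ Finset.range (n + 1), Y i ω) ^ 2 / (n + 1) -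
          c * ∑ i ∈ Finset.range (n + 1), Y i ω ^ 2)) (by fun_prop) (fun ω hω => ?_) ?_
  · rw [← Real.exp_add]
    refine Real.one_le_exp ?_
    have h1 : m ω + √(V ω) * y ≤ -δ := hω
    have h2 : δ ^ 2 + V ω * y ^ 2 ≤ m ω ^ 2 := by
      have h3 : 0 ≤ √(V ω) * y := by positivity
      have h4 : (√(V ω) * y) ^ 2 = V ω * y ^ 2 := by rw [mul_pow, Real.sq_sqrt (hV0 ω)]
      nlinarith
    have h5 : (∑ i ∈ Finset.range (n + 1), Y i ω) = (n + 1) * m ω := by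
      rw [hm]; field_simp
    have h6 : (∑ i ∈ Finset.range (n + 1), Y i ω ^ 2) = (n + 1) * (V ω + m ω ^ 2) := by
      rw [hV]; field_simp; ring
    rw [h5, h6, hc]
    have h7 : -(t * δ ^ 2 * (n + 1)) + ((t + t * y ^ 2) * ((n + 1) * m ω) ^ 2 / (n + 1) -
        t * y ^ 2 * ((n + 1) * (V ω + m ω ^ 2))) =
        t * (n + 1) * (m ω ^ 2 - (δ ^ 2 + V ω * y ^ 2)) := by field_simp; ring
    rw [h7]
    have : 0 ≤ t := by linarith
    have h8 : 0 ≤ m ω ^ 2 - (δ ^ 2 + V ω * y ^ 2) := by linarith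
    positivity
  · simp_rw [ENNReal.ofReal_mul (Real.exp_pos (-(t * δ ^ 2 * (n + 1)))).le]
    rw [lintegral_const_mul' _ _ ENNReal.ofReal_ne_top, hY.lintegral_exp_mean_sq_sub_var n hc0,
      ← ENNReal.ofReal_mul (Real.exp_pos _).le]
    refine ENNReal.ofReal_le_ofReal ?_
    have h1 : Real.exp (-(t * δ ^ 2 * (n + 1))) ≤ Real.exp (-(δ ^ 2 / 4 * (n + 1))) := by
      refine Real.exp_le_exp.2 (neg_le_neg (mul_le_mul_of_nonneg_right ?_ (by positivity)))
      nlinarith [sq_nonneg δ]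
    have h2 : √((n : ℝ) + 1) ≤ n + 1 := Real.sqrt_le_iff.2 ⟨by positivity, by nlinarith⟩
    calc _ ≤ Real.exp (-(δ ^ 2 / 4 * (n + 1))) * ((n + 1) * (2 * Real.exp (-b))) := by
          refine mul_le_mul h1 (mul_le_mul h2 (inv_sqrt_pow_le hn hA) (by positivity)
            (by positivity)) (by positivity) (Real.exp_pos _).le
      _ = _ := by ring

end

section

/-! ### Runs of a policy in terms of the reward table -/

/-- The mean of the first `s` rewards of arm `k` in the reward table `ω`. -/
def armMean {K : ℕ} (ω : Fin K × ℕ → ℝ) (k : Fin K) (s : ℕ) : ℝ :=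
  (∑ t ∈ Finset.range s, ω (k, t)) / s

/-- The variance of the first `s` rewards of arm `k` in the reward table `ω`. -/
def armVar {K : ℕ} (ω : Fin K × ℕ → ℝ) (k : Fin K) (s : ℕ) : ℝ :=
  (∑ t ∈ Finset.range s, (ω (k, t) - armMean ω k s) ^ 2) / s

/-- The upper confidence bound with coefficient `b` of arm `k` after `s` of its rewards. It is
real-valued, hence meaningful for `s ≥ 2` only. -/
def armUCB {K : ℕ} (b : ℝ) (ω : Fin K × ℕ → ℝ) (k : Fin K) (s : ℕ) : ℝ :=
  armMean ω k s + √(armVar ω k s) * √(Real.exp (2 * b / ((s : ℝ) - 1)) - 1)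

variable {K : ℕ} (π : Policy K) (ω : Fin K × ℕ → ℝ)

theorem count_history_succ (n : ℕ) (k : Fin K) :
    count (history π ω (n + 1)) k =
      count (history π ω n) k + if π.act n (history π ω n) = k then 1 else 0 := by
  simp only [count, Finset.card_filter]
  rw [Fin.sum_univ_castSucc]
  simp [history]

/-- The rewards of arm `k` in a run are the first rewards of that arm in the table. -/
theorem sum_history (f : ℝ → ℝ) (n : ℕ) (k : Fin K) :
    ∑ i ∈ Finset.univ.filter (fun i => (history π ω n i).1 = k), f (history π ω n i).2 =
      ∑ t ∈ Finset.range (count (history π ω n) k), f (ω (k, t)) := by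
  induction n with
  | zero => simp [count]
  | succ n ih =>
    rw [count_history_succ]
    rw [Finset.sum_filter] at ih ⊢
    rw [Fin.sum_univ_castSucc]
    simp only [history, Fin.snoc_castSucc, Fin.snoc_last] at ih ⊢
    rw [ih]
    by_cases h : π.act n (history π ω n) = k
    · simp [h, Finset.sum_range_succ]
    · simp [h]

theorem ucb_history_of_count {b : ℝ} {n : ℕ} {k : Fin K} (h : 2 ≤ count (history π ω n) k) :
    ucb b (history π ω n) k = (armUCB b ω k (count (history π ω n) k) : ℝ) := by
  have hmean : sampleMean (history π ω n) k = armMean ω k (count (history π ω n) k) := by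
    rw [sampleMean, armMean, sum_history π ω (fun x => x)]
  rw [ucb, if_neg (by omega), armUCB, sampleVar, armVar, hmean, sum_history π ω
    (fun x => (x - armMean ω k (count (history π ω n) k)) ^ 2)]

theorem count_le (n : ℕ) (k : Fin K) : count (history π ω n) k ≤ n := by
  simpa [count] using Finset.card_filter_le (Finset.univ : Finset (Fin n)) _

theorem armUCB_mono {b b' : ℝ} (hb : b ≤ b') (k : Fin K) {s : ℕ} (hs : 1 ≤ s) :
    armUCB b ω k s ≤ armUCB b' ω k s := by
  have hs' : (0 : ℝ) ≤ (s : ℝ) - 1 := by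
    have : (1 : ℝ) ≤ s := by exact_mod_cast hs
    linarith
  unfold armUCB
  gcongr

/-- The reward tables in which the upper confidence bound of arm `k` with coefficient `b` is below
`x` at some sample size from `2` to `n`. -/
def lowEvent (b x : ℝ) (k : Fin K) (n : ℕ) : Set (Fin K × ℕ → ℝ) :=
  {ω | ∃ s ∈ Finset.Icc 2 n, armUCB b ω k s < x}

theorem lowEvent_eq_biUnion (b x : ℝ) (k : Fin K) (n : ℕ) :
    lowEvent b x k n = ⋃ s ∈ Finset.Icc 2 n, {ω | armUCB b ω k s < x} := by
  ext ω
  simp [lowEvent]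

/-- The reward tables in which the upper confidence bound of arm `k` with coefficient `b` reaches
`x` at sample size `s`; all tables for `s ≤ 1`, where the bound is infinite. -/
def highEvent (b x : ℝ) (k : Fin K) (s : ℕ) : Set (Fin K × ℕ → ℝ) :=
  {ω | s ≤ 1 ∨ x ≤ armUCB b ω k s}

/-- An arm is sampled either while the confidence bound of the reference arm `l` is below the
level `x`, or while its own bound is at least `x`. The latter happens at most once per sample
size of the arm, and then the bound with the final coefficient is at least `x` as well. -/
theorem count_sub_one_le {b : ℕ → ℝ} (hπ : IsUCB b π) (x : ℝ) (k l : Fin K) (N : ℕ) {B : ℝ}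
    (hb : ∀ n, K ≤ n → n < N → b n ≤ B) :
    max ((count (history π ω N) k : ℝ) - 1) 0 ≤
      (∑ n ∈ Finset.Ico K N, if π.act n (history π ω n) = k then
        (lowEvent (b n) x l n).indicator 1 ω else 0) +
      ∑ s ∈ Finset.Ico 1 (count (history π ω N) k), (highEvent B x k s).indicator 1 ω := by
  induction N with
  | zero => simp [count]
  | succ n ih =>
    specialize ih fun m h1 h2 => hb m h1 (by omega)
    have hpos : (0 : ℝ) ≤ if π.act n (history π ω n) = k then
        (lowEvent (b n) x l n).indicator 1 ω else 0 := by
      split_ifs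
      · exact Set.indicator_nonneg (fun _ _ => zero_le_one) _
      · exact le_rfl
    have hstep : (∑ m ∈ Finset.Ico K n, if π.act m (history π ω m) = k then
        (lowEvent (b m) x l m).indicator (1 : (Fin K × ℕ → ℝ) → ℝ) ω else 0) ≤
        ∑ m ∈ Finset.Ico K (n + 1), if π.act m (history π ω m) = k then
        (lowEvent (b m) x l m).indicator (1 : (Fin K × ℕ → ℝ) → ℝ) ω else 0 := by
      rcases le_or_gt K n with h | h
      · rw [Finset.sum_Ico_succ_top h]; linarith
      · rw [Finset.Ico_eq_empty (by omega), Finset.Ico_eq_empty (by omega)]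
    rw [count_history_succ]
    by_cases hact : π.act n (history π ω n) = k
    · rw [if_pos hact]
      rcases Nat.eq_zero_or_pos (count (history π ω n) k) with h0 | h0
      · rw [h0] at ih ⊢
        simp only [zero_add, Nat.cast_one, sub_self, max_self]
        refine le_trans ?_ (add_le_add hstep le_rfl)
        simpa using ih
      · -- The first `K` samples are from arms without rewards, so a second one comes later.
        have hKn : K ≤ n := by
          by_contra hlt
          have := hπ.init n (by omega) (history π ω n)
          rw [hact] at this
          omega
        have hone : (1 : ℝ) ≤ (lowEvent (b n) x l n).indicator 1 ω +
            (highEvent B x k (count (history π ω n) k)).indicator 1 ω := by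
          by_cases hlow : ω ∈ lowEvent (b n) x l n
          · rw [Set.indicator_of_mem hlow]
            have : (0 : ℝ) ≤ (highEvent B x k (count (history π ω n) k)).indicator 1 ω :=
              Set.indicator_nonneg (fun _ _ => zero_le_one) _
            simpa using this
          · have hhigh : ω ∈ highEvent B x k (count (history π ω n) k) := by
              rcases Nat.lt_or_ge (count (history π ω n) k) 2 with h1 | h1
              · exact Or.inl (by omega)
              · right
                have hmax := hπ.maximal n hKn (history π ω n) l
                rw [hact, ucb_history_of_count π ω h1] at hmax
                have hl2 : 2 ≤ count (history π ω n) l := by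
                  by_contra hlt
                  rw [ucb, if_pos (by omega)] at hmax
                  exact absurd hmax (by simp)
                rw [ucb_history_of_count π ω hl2, EReal.coe_le_coe_iff] at hmax
                have hx : x ≤ armUCB (b n) ω l (count (history π ω n) l) := by
                  by_contra hlt
                  exact hlow ⟨_, Finset.mem_Icc.2 ⟨hl2, count_le π ω n l⟩, not_le.1 hlt⟩
                exact hx.trans (hmax.trans
                  (armUCB_mono ω (hb n hKn (by omega)) k (by omega)))
            rw [Set.indicator_of_mem hhigh]
            have : (0 : ℝ) ≤ (lowEvent (b n) x l n).indicator 1 ω :=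
              Set.indicator_nonneg (fun _ _ => zero_le_one) _
            simpa using this
        rw [Finset.sum_Ico_succ_top hKn, if_pos hact, Finset.sum_Ico_succ_top h0]
        have h1 : (1 : ℝ) ≤ count (history π ω n) k := by exact_mod_cast h0
        rw [max_eq_left (by linarith)] at ih
        push_cast
        rw [max_eq_left (by linarith)]
        linarith
    · rw [if_neg hact, add_zero]
      linarith

theorem measurable_count {n : ℕ} (k : Fin K) : Measurable fun h : History K n => count h k := by
  simp only [count, Finset.card_filter]
  refine Finset.measurable_sum _ fun i _ => Measurable.ite ?_ measurable_const measurable_const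
  exact (measurable_fst.comp (measurable_pi_apply i)) (measurableSet_singleton k)

theorem measurable_history (n : ℕ) : Measurable fun ω => history π ω n := by
  induction n with
  | zero => exact measurable_pi_lambda _ fun i => i.elim0
  | succ n ih =>
    have hact : Measurable fun ω => π.act n (history π ω n) := (π.measurable_act n).comp ih
    have hpair : Measurable fun p : Fin K × History K n => count p.2 p.1 :=
      measurable_from_prod_countable_right fun k => measurable_count k
    have heval : Measurable fun p : (Fin K × ℕ) × (Fin K × ℕ → ℝ) => p.2 p.1 :=
      measurable_from_prod_countable_right fun k => measurable_pi_apply k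
    refine measurable_pi_lambda _ fun i => ?_
    refine Fin.lastCases ?_ (fun i => ?_) i
    · simp only [history, Fin.snoc_last]
      exact hact.prodMk (heval.comp ((hact.prodMk (hpair.comp (hact.prodMk ih))).prodMk
        measurable_id))
    · simp only [history, Fin.snoc_castSucc]
      exact (measurable_pi_apply i).comp ih

theorem measurable_count_history (n : ℕ) (k : Fin K) :
    Measurable fun ω => count (history π ω n) k :=
  (measurable_count k).comp (measurable_history π n)

theorem measurable_armUCB (b : ℝ) (k : Fin K) (s : ℕ) : Measurable fun ω => armUCB b ω k s := by
  unfold armUCB armVar armMean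
  fun_prop

theorem measurableSet_lowEvent (b x : ℝ) (k : Fin K) (n : ℕ) :
    MeasurableSet (lowEvent b x k n) := by
  rw [lowEvent_eq_biUnion]
  exact Finset.measurableSet_biUnion _ fun s _ =>
    measurableSet_lt (measurable_armUCB b k s) measurable_const

theorem measurableSet_highEvent (b x : ℝ) (k : Fin K) (s : ℕ) :
    MeasurableSet (highEvent b x k s) :=
  (MeasurableSet.const _).union (measurableSet_le measurable_const (measurable_armUCB b k s))

end

section

/-! ### Two elementary sums -/

theorem sum_exp_neg_mul_le {x : ℝ} (hx : 0 < x) {S : Finset ℕ} (hS : ∀ s ∈ S, 1 ≤ s) :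
    ∑ s ∈ S, Real.exp (-(x * s)) ≤ 1 / x := by
  have h1 : ∀ n : ℕ, ∑ s ∈ Finset.range n, Real.exp (-(x * (s + 1 : ℕ))) ≤
      (1 - Real.exp (-(x * n))) / x := by
    intro n
    induction n with
    | zero => simp
    | succ n ih =>
      rw [Finset.sum_range_succ]
      have h2 : Real.exp (-(x * (n + 1 : ℕ))) ≤
          (Real.exp (-(x * n)) - Real.exp (-(x * (n + 1 : ℕ)))) / x := by
        rw [le_div_iff₀ hx]
        have h3 : Real.exp (-(x * n)) = Real.exp (-(x * (n + 1 : ℕ))) * Real.exp x := by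
          rw [← Real.exp_add]; congr 1; push_cast; ring
        rw [h3]
        nlinarith [Real.exp_pos (-(x * (n + 1 : ℕ))), Real.add_one_le_exp x]
      calc _ ≤ (1 - Real.exp (-(x * n))) / x +
            (Real.exp (-(x * n)) - Real.exp (-(x * (n + 1 : ℕ)))) / x := add_le_add ih h2
        _ = _ := by ring
  have h4 : S ⊆ (Finset.range (S.sup id)).image (· + 1) := by
    intro s hs
    have h5 : s ≤ S.sup id := Finset.le_sup (f := id) hs
    have := hS s hs
    exact Finset.mem_image.2 ⟨s - 1, Finset.mem_range.2 (by omega), by omega⟩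
  calc _ ≤ ∑ s ∈ (Finset.range (S.sup id)).image (fun m : ℕ => m + 1), Real.exp (-(x * s)) :=
        Finset.sum_le_sum_of_subset_of_nonneg h4 fun _ _ _ => (Real.exp_pos _).le
    _ = ∑ s ∈ Finset.range (S.sup id), Real.exp (-(x * (s + 1 : ℕ))) :=
        Finset.sum_image fun a _ b _ h => by simpa using h
    _ ≤ _ := (h1 _).trans
        (div_le_div_of_nonneg_right (by linarith [Real.exp_pos (-(x * (S.sup id : ℕ)))]) hx.le)

theorem sum_mul_exp_neg_mul_le {x : ℝ} (hx : 0 < x) {S : Finset ℕ} (hS : ∀ s ∈ S, 1 ≤ s) :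
    ∑ s ∈ S, (s : ℝ) * Real.exp (-(x * s)) ≤ 4 / x ^ 2 := by
  have h1 : ∀ s ∈ S, (s : ℝ) * Real.exp (-(x * s)) ≤ 2 / x * Real.exp (-(x / 2 * s)) := by
    intro s _
    have h2 : Real.exp (-(x * s)) = Real.exp (-(x / 2 * s)) * Real.exp (-(x / 2 * s)) := by
      rw [← Real.exp_add]; congr 1; ring
    rw [h2, ← mul_assoc]
    refine mul_le_mul_of_nonneg_right ?_ (Real.exp_pos _).le
    rw [Real.exp_neg, ← div_eq_mul_inv, div_le_div_iff₀ (Real.exp_pos _) hx]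
    linarith [Real.add_one_le_exp (x / 2 * s)]
  refine (Finset.sum_le_sum h1).trans ?_
  rw [← Finset.mul_sum]
  calc _ ≤ 2 / x * (1 / (x / 2)) := mul_le_mul_of_nonneg_left
        (sum_exp_neg_mul_le (half_pos hx) hS) (by positivity)
    _ = _ := by field_simp; norm_num

/-! ### Upper confidence bounds under the normal model -/

instance {K : ℕ} (θ : Params K) : IsProbabilityMeasure (rewardLaw θ) := by
  unfold rewardLaw; infer_instance

variable {K : ℕ} {θ : Params K} {k : Fin K}

theorem isStdNormalSeq_standardized (hσ : 0 < sd θ k) :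
    IsStdNormalSeq (fun t (ω : Fin K × ℕ → ℝ) => (ω (k, t) - mean θ k) / sd θ k)
      (rewardLaw θ) where
  indep := by
    have h1 := iIndepFun_infinitePi (P := fun p : Fin K × ℕ => gaussianReal (θ p.1).1 (θ p.1).2)
      (X := fun p x => (x - mean θ p.1) / sd θ p.1) (fun p => by fun_prop)
    exact h1.precomp (g := fun t : ℕ => (k, t)) fun a b h => by simpa using h
  meas := fun i => by fun_prop
  law := fun t => by
    have h1 : (rewardLaw θ).map (fun ω => ω (k, t)) = gaussianReal (θ k).1 (θ k).2 :=
      Measure.infinitePi_map_eval (fun p : Fin K × ℕ => gaussianReal (θ p.1).1 (θ p.1).2) (k, t)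
    have h2 : (fun ω : Fin K × ℕ → ℝ => (ω (k, t) - mean θ k) / sd θ k) =
        (fun x => x / sd θ k) ∘ (fun x => x - mean θ k) ∘ (fun ω => ω (k, t)) := rfl
    rw [h2, ← Measure.map_map (by fun_prop) (by fun_prop),
      ← Measure.map_map (by fun_prop) (by fun_prop), h1, gaussianReal_map_sub_const,
      gaussianReal_map_div_const]
    congr 1
    · simp [mean]
    · have hv : (θ k).2 ≠ 0 := by
        intro h
        simp [sd, h] at hσ
      ext
      have : ((θ k).2 : ℝ) ≠ 0 := by exact_mod_cast hv
      simp [sd, this]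

/-- The mean of the first `s` standardized rewards of arm `k`. -/
def stdMean (θ : Params K) (k : Fin K) (s : ℕ) (ω : Fin K × ℕ → ℝ) : ℝ :=
  (∑ t ∈ Finset.range s, (ω (k, t) - mean θ k) / sd θ k) / s

/-- The variance of the first `s` standardized rewards of arm `k`. -/
def stdVar (θ : Params K) (k : Fin K) (s : ℕ) (ω : Fin K × ℕ → ℝ) : ℝ :=
  (∑ t ∈ Finset.range s, ((ω (k, t) - mean θ k) / sd θ k) ^ 2) / s - stdMean θ k s ω ^ 2

theorem armMean_eq (hσ : 0 < sd θ k) {s : ℕ} (hs : 1 ≤ s) (ω : Fin K × ℕ → ℝ) :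
    armMean ω k s = mean θ k + sd θ k * stdMean θ k s ω := by
  have hs0 : (s : ℝ) ≠ 0 := by positivity
  rw [armMean, stdMean, ← Finset.sum_div, Finset.sum_sub_distrib]
  simp only [Finset.sum_const, Finset.card_range, nsmul_eq_mul]
  field_simp
  ring

theorem armVar_eq (hσ : 0 < sd θ k) {s : ℕ} (hs : 1 ≤ s) (ω : Fin K × ℕ → ℝ) :
    armVar ω k s = sd θ k ^ 2 * stdVar θ k s ω := by
  have hs0 : (s : ℝ) ≠ 0 := by positivity
  set Z : ℕ → ℝ := fun t => (ω (k, t) - mean θ k) / sd θ k with hZ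
  have h1 : ∀ t, (ω (k, t) - armMean ω k s) ^ 2 =
      sd θ k ^ 2 * (Z t ^ 2 - 2 * stdMean θ k s ω * Z t + stdMean θ k s ω ^ 2) := by
    intro t
    rw [armMean_eq hσ hs, hZ]
    field_simp
    ring
  have h2 : ∑ t ∈ Finset.range s, Z t = s * stdMean θ k s ω := by
    rw [stdMean, mul_div_cancel₀ _ hs0]
  have h3 : stdVar θ k s ω = (∑ t ∈ Finset.range s, Z t ^ 2) / s - stdMean θ k s ω ^ 2 := rfl
  rw [armVar, h3]
  simp_rw [h1]
  rw [← Finset.mul_sum, Finset.sum_add_distrib, Finset.sum_sub_distrib, ← Finset.mul_sum, h2]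
  simp only [Finset.sum_const, Finset.card_range, nsmul_eq_mul]
  generalize ∑ t ∈ Finset.range s, Z t ^ 2 = Q
  field_simp
  ring

theorem stdVar_nonneg (hσ : 0 < sd θ k) {s : ℕ} (hs : 1 ≤ s) (ω : Fin K × ℕ → ℝ) :
    0 ≤ stdVar θ k s ω := by
  have h1 : 0 ≤ armVar ω k s := by unfold armVar; positivity
  rw [armVar_eq hσ hs] at h1
  exact nonneg_of_mul_nonneg_right h1 (by positivity)

theorem armUCB_eq (hσ : 0 < sd θ k) {s : ℕ} (hs : 1 ≤ s) (b : ℝ) (ω : Fin K × ℕ → ℝ) :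
    armUCB b ω k s = mean θ k + sd θ k * (stdMean θ k s ω +
      √(stdVar θ k s ω) * √(Real.exp (2 * b / ((s : ℝ) - 1)) - 1)) := by
  rw [armUCB, armMean_eq hσ hs, armVar_eq hσ hs, Real.sqrt_mul (by positivity),
    Real.sqrt_sq hσ.le]
  ring

theorem measureReal_armUCB_lt_le (hσ : 0 < sd θ k) {s : ℕ} (hs : 2 ≤ s) (b : ℝ) {δ : ℝ}
    (hδ : 0 < δ) :
    (rewardLaw θ).real {ω | armUCB b ω k s < mean θ k - δ} ≤
      2 * s * Real.exp (-b) * Real.exp (-((δ / sd θ k) ^ 2 / 4 * s)) := by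
  obtain ⟨n, rfl⟩ : ∃ n, s = n + 1 := ⟨s - 1, by omega⟩
  have h1 := (isStdNormalSeq_standardized hσ).measureReal_ucb_le (show 1 ≤ n by omega) b
    (div_pos hδ hσ).le (stdMean θ k (n + 1)) (stdVar θ k (n + 1))
    (fun ω => by rw [stdMean]; push_cast; rfl) (fun ω => by rw [stdVar]; push_cast; rfl)
    (stdVar_nonneg hσ (by omega))
  have h2 : (rewardLaw θ).real {ω | armUCB b ω k (n + 1) < mean θ k - δ} ≤
      (rewardLaw θ).real {ω | stdMean θ k (n + 1) ω +
        √(stdVar θ k (n + 1) ω) * √(Real.exp (2 * b / n) - 1) ≤ -(δ / sd θ k)} := by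
    refine measureReal_mono fun ω hω => ?_
    have h3 : armUCB b ω k (n + 1) < mean θ k - δ := hω
    rw [armUCB_eq hσ (by omega)] at h3
    push_cast at h3
    rw [add_sub_cancel_right] at h3
    rw [Set.mem_ofPred_eq, ← neg_div, le_div_iff₀ hσ, mul_comm]
    linarith
  push_cast
  exact h2.trans h1

/-- A union bound over the sample sizes. The factor `exp (-b)` survives, and the margin `δ` makes
the remaining sum converge. -/
theorem measureReal_lowEvent_le (hσ : 0 < sd θ k) (b : ℝ) {δ : ℝ} (hδ : 0 < δ) (n : ℕ) :
    (rewardLaw θ).real (lowEvent b (mean θ k - δ) k n) ≤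
      128 * (sd θ k / δ) ^ 4 * Real.exp (-b) := by
  rw [lowEvent_eq_biUnion]
  refine (measureReal_biUnion_finset_le _ _).trans ?_
  calc _ ≤ ∑ s ∈ Finset.Icc 2 n, 2 * Real.exp (-b) *
        (s * Real.exp (-((δ / sd θ k) ^ 2 / 4 * s))) := by
        refine Finset.sum_le_sum fun s hs => ?_
        refine (measureReal_armUCB_lt_le hσ (Finset.mem_Icc.1 hs).1 b hδ).trans (le_of_eq ?_)
        ring
    _ ≤ 2 * Real.exp (-b) * (4 / ((δ / sd θ k) ^ 2 / 4) ^ 2) := by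
        rw [← Finset.mul_sum]
        refine mul_le_mul_of_nonneg_left (sum_mul_exp_neg_mul_le (by positivity) ?_) (by positivity)
        intro s hs
        have := (Finset.mem_Icc.1 hs).1
        omega
    _ = _ := by field_simp; norm_num

/-- Concavity of the logarithm, in the form of Bernoulli's inequality. -/
theorem mul_M_le {c : ℝ} (hc0 : 0 ≤ c) (hc1 : c ≤ 1) (z : ℝ) :
    c * M z ≤ 1 / 2 * Real.log (1 + c * z ^ 2) := by
  have h1 : Real.log ((1 + z ^ 2) ^ c) ≤ Real.log (1 + c * z ^ 2) :=
    Real.log_le_log (by positivity)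
      (rpow_one_add_le_one_add_mul_self (by nlinarith [sq_nonneg z]) hc0 hc1)
  rw [Real.log_rpow (by positivity)] at h1
  unfold M
  linarith

theorem M_pos {z : ℝ} (hz : 0 < z) : 0 < M z := by
  have := Real.log_pos (show (1 : ℝ) < 1 + z ^ 2 by nlinarith)
  unfold M
  linarith

theorem M_le_half_sq (z : ℝ) : M z ≤ z ^ 2 / 2 := by
  have := Real.log_le_sub_one_of_pos (show (0 : ℝ) < 1 + z ^ 2 by positivity)
  unfold M
  linarith

/-- The factor by which `M` shrinks when means and standard deviations are only known up to
relative errors of order `ε`. -/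
def slack (ε : ℝ) : ℝ := (1 - 2 * ε) ^ 2 / (1 + ε)

theorem slack_pos {ε : ℝ} (hε : 0 < ε) (hε' : ε < 1 / 2) : 0 < slack ε := by
  have : 0 < 1 - 2 * ε := by linarith
  unfold slack
  positivity

/-- The exponential rate at which the sample variance exceeds `(1 + ε)` times the variance. -/
def varRate (ε : ℝ) : ℝ := (ε - Real.log (1 + ε)) / 2

theorem varRate_pos {ε : ℝ} (hε : 0 < ε) : 0 < varRate ε := by
  have := Real.log_lt_sub_one_of_pos (show (0 : ℝ) < 1 + ε by linarith) (by linarith)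
  unfold varRate
  linarith

/-- With more than `B / (c M (d / σ)) + 1` rewards, the upper confidence bound of an arm stays
below its mean plus `(1 - ε) d`, unless the sample mean or the sample variance is too large. -/
theorem measureReal_armUCB_ge_le (hσ : 0 < sd θ k) {ε d B x : ℝ} (hε : 0 < ε) (hε' : ε < 1 / 2)
    (hd : 0 < d) (hx : mean θ k + (1 - ε) * d ≤ x) {s : ℕ} (hs : 2 ≤ s)
    (hsB : B / (slack ε * M (d / sd θ k)) + 1 < s) :
    (rewardLaw θ).real {ω | x ≤ armUCB B ω k s} ≤
      Real.exp (-((ε * (d / sd θ k)) ^ 2 / 2 * s)) + Real.exp (-(varRate ε * s)) := by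
  set z : ℝ := d / sd θ k with hz
  have hz0 : 0 < z := div_pos hd hσ
  have hdz : d = sd θ k * z := by rw [hz]; field_simp
  have hY := isStdNormalSeq_standardized hσ
  have hs2 : (2 : ℝ) ≤ s := by exact_mod_cast hs
  have hs0 : (0 : ℝ) < s := by linarith
  have hε1 : 0 < 1 + ε := by linarith
  have hc0 := slack_pos hε hε'
  have hc1 : slack ε ≤ 1 := by
    rw [slack, div_le_one hε1]
    nlinarith
  have h0 := add_le_add (hY.measureReal_sum_ge_le s (a := ε * z) (by positivity))
    (hY.measureReal_sum_sq_ge_le s hε)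
  refine le_trans ?_ ((measureReal_union_le _ _).trans h0)
  refine measureReal_mono fun ω hω => ?_
  by_contra hnot
  simp only [Set.mem_union, Set.mem_ofPred_eq, not_or, not_le] at hnot
  obtain ⟨hmean, hsq⟩ := hnot
  have h1 : stdMean θ k s ω < ε * z := by rwa [stdMean, div_lt_iff₀ hs0]
  have h2 : stdVar θ k s ω ≤ 1 + ε := by
    have : (∑ t ∈ Finset.range s, ((ω (k, t) - mean θ k) / sd θ k) ^ 2) / s ≤ 1 + ε := by
      rw [div_le_iff₀ hs0]; exact hsq.le
    rw [stdVar]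
    nlinarith [sq_nonneg (stdMean θ k s ω)]
  have h3 : Real.exp (2 * B / ((s : ℝ) - 1)) ≤ 1 + slack ε * z ^ 2 := by
    rw [← Real.le_log_iff_exp_le (by positivity)]
    have h4 : B / ((s : ℝ) - 1) ≤ slack ε * M z := by
      rw [div_le_iff₀ (by linarith)]
      have h5 : B / (slack ε * M z) < s - 1 := by linarith
      rw [div_lt_iff₀ (mul_pos hc0 (M_pos hz0))] at h5
      linarith
    have h6 := mul_M_le hc0.le hc1 z
    rw [mul_div_assoc]
    linarith
  have h7 : √(stdVar θ k s ω) * √(Real.exp (2 * B / ((s : ℝ) - 1)) - 1) ≤ (1 - 2 * ε) * z := by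
    have h8 : 0 ≤ (1 - 2 * ε) * z := mul_nonneg (by linarith) hz0.le
    calc _ ≤ √(1 + ε) * √(slack ε * z ^ 2) := mul_le_mul (Real.sqrt_le_sqrt h2)
          (Real.sqrt_le_sqrt (by linarith)) (Real.sqrt_nonneg _) (Real.sqrt_nonneg _)
      _ = √(((1 - 2 * ε) * z) ^ 2) := by
          rw [← Real.sqrt_mul hε1.le, slack]
          congr 1
          field_simp
      _ = _ := Real.sqrt_sq h8
  have h9 : x ≤ armUCB B ω k s := hω
  rw [armUCB_eq hσ (by omega)] at h9
  have h10 : sd θ k * (stdMean θ k s ω +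
      √(stdVar θ k s ω) * √(Real.exp (2 * B / ((s : ℝ) - 1)) - 1)) < sd θ k * ((1 - ε) * z) :=
    mul_lt_mul_of_pos_left (by linarith) hσ
  rw [hdz] at hx
  linarith

/-- The expected number of sample sizes at which the confidence bound of an arm is too high, with
error terms that are small against `log N / M (d / σ)` uniformly in the arm: `M (d / σ)` may be
small or large, which is why it is kept in the numerator as well. -/
theorem sum_measureReal_highEvent_le (hσ : 0 < sd θ k) {ε d B x : ℝ} (hε : 0 < ε)
    (hε' : ε < 1 / 2) (hd : 0 < d) (hB : 0 ≤ B) (hx : mean θ k + (1 - ε) * d ≤ x) (N : ℕ) :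
    ∑ s ∈ Finset.Ico 1 N, (rewardLaw θ).real (highEvent B x k s) ≤
      (B / slack ε + 1 / ε ^ 2 + (1 + 1 / varRate ε) * M (d / sd θ k)) / M (d / sd θ k) := by
  set z : ℝ := d / sd θ k with hz
  have hz0 : 0 < z := div_pos hd hσ
  have hM := M_pos hz0
  have hκ := varRate_pos hε
  have hc0 := slack_pos hε hε'
  set τ : ℝ := B / (slack ε * M z) with hτ
  have hτ0 : 0 ≤ τ := by positivity
  have hterm : ∀ s ∈ Finset.Ico 1 N, (rewardLaw θ).real (highEvent B x k s) ≤
      (if (s : ℝ) ≤ τ + 1 then 1 else 0) + Real.exp (-((ε * z) ^ 2 / 2 * s)) +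
        Real.exp (-(varRate ε * s)) := by
    intro s hs
    have h1 := Real.exp_pos (-((ε * z) ^ 2 / 2 * s))
    have h2 := Real.exp_pos (-(varRate ε * s))
    split_ifs with h
    · have : (rewardLaw θ).real (highEvent B x k s) ≤ 1 := measureReal_le_one
      linarith
    · have hs2 : 2 ≤ s := by
        by_contra hlt
        have : s = 1 := by have := (Finset.mem_Ico.1 hs).1; omega
        apply h
        rw [this]
        push_cast
        linarith
      have h3 : highEvent B x k s = {ω | x ≤ armUCB B ω k s} := by
        ext ω
        simp only [highEvent, Set.mem_ofPred_eq, or_iff_right_iff_imp]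
        intro h4
        omega
      rw [h3, zero_add]
      exact measureReal_armUCB_ge_le hσ hε hε' hd hx hs2 (not_le.1 h)
  have hS : ∀ s ∈ Finset.Ico 1 N, 1 ≤ s := fun s hs => (Finset.mem_Ico.1 hs).1
  refine (Finset.sum_le_sum hterm).trans ?_
  rw [Finset.sum_add_distrib, Finset.sum_add_distrib]
  have h1 : ∑ s ∈ Finset.Ico 1 N, (if (s : ℝ) ≤ τ + 1 then (1 : ℝ) else 0) ≤ τ + 1 := by
    rw [Finset.sum_boole]
    have hsub : (Finset.Ico 1 N).filter (fun s : ℕ => (s : ℝ) ≤ τ + 1) ⊆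
        Finset.Icc 1 ⌊τ + 1⌋₊ := by
      intro s hs
      rw [Finset.mem_filter] at hs
      exact Finset.mem_Icc.2 ⟨(Finset.mem_Ico.1 hs.1).1, Nat.le_floor hs.2⟩
    have h2 := Finset.card_le_card hsub
    rw [Nat.card_Icc, Nat.add_sub_cancel] at h2
    exact (Nat.cast_le.2 h2).trans (Nat.floor_le (by linarith))
  have h2 := sum_exp_neg_mul_le (show 0 < (ε * z) ^ 2 / 2 by positivity) hS
  have h3 := sum_exp_neg_mul_le hκ hS
  have h4 : 1 / ((ε * z) ^ 2 / 2) ≤ 1 / ε ^ 2 / M z := by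
    rw [div_div]
    refine one_div_le_one_div_of_le (by positivity) ?_
    have := mul_le_mul_of_nonneg_left (M_le_half_sq z) (sq_nonneg ε)
    nlinarith
  have h5 : (B / slack ε + 1 / ε ^ 2 + (1 + 1 / varRate ε) * M z) / M z =
      τ + 1 / ε ^ 2 / M z + (1 + 1 / varRate ε) := by
    rw [hτ]; field_simp
  rw [h5]
  linarith

/-! ### The regret bound for a fixed parameter -/

theorem mean_le_best (θ : Params K) (k : Fin K) : mean θ k ≤ best θ :=
  le_ciSup (Set.finite_range _).bddAbove k

theorem integrable_max_count (π : Policy K) (N : ℕ) (k : Fin K) :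
    Integrable (fun ω => max ((count (history π ω N) k : ℝ) - 1) 0) (rewardLaw θ) := by
  refine Integrable.of_bound (C := N) ?_ (ae_of_all _ fun ω => ?_)
  · refine Measurable.aestronglyMeasurable ?_
    exact (measurable_from_nat (f := fun n : ℕ => max ((n : ℝ) - 1) 0)).comp
      (measurable_count_history π N k)
  · have : (count (history π ω N) k : ℝ) ≤ N := by exact_mod_cast count_le π ω N k
    rw [Real.norm_of_nonneg (le_max_right _ _)]
    exact max_le (by linarith) (by positivity)

/-- Arms are compared with an optimal arm `l`: a sampling of an inferior arm is charged to the
event that the confidence bound of `l` is low, at any one step at most once in total, or to the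
event that the bound of the inferior arm is high, at most once per sample size. -/
theorem tildeRegret_le_sum_measureReal {b : ℕ → ℝ} {π : Policy K} (hπ : IsUCB b π) (θ : Params K)
    (x : ℝ) (l : Fin K) (N : ℕ) {B D : ℝ} (hb : ∀ n, K ≤ n → n < N → b n ≤ B)
    (hD : ∀ k, best θ - mean θ k ≤ D) :
    tildeRegret π θ N ≤
      D * ∑ n ∈ Finset.Ico K N, (rewardLaw θ).real (lowEvent (b n) x l n) +
      ∑ k ∈ inferior θ, (best θ - mean θ k) *
        ∑ s ∈ Finset.Ico 1 N, (rewardLaw θ).real (highEvent B x k s) := by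
  have hgap : ∀ k, 0 ≤ best θ - mean θ k := fun k => sub_nonneg.2 (mean_le_best θ k)
  have hind : ∀ (S : Set (Fin K × ℕ → ℝ)) ω, (0 : ℝ) ≤ S.indicator 1 ω :=
    fun S ω => Set.indicator_nonneg (fun _ _ => zero_le_one) _
  have hpt : ∀ ω, ∑ k, (best θ - mean θ k) * max ((count (history π ω N) k : ℝ) - 1) 0 ≤
      D * (∑ n ∈ Finset.Ico K N, (lowEvent (b n) x l n).indicator 1 ω) +
      ∑ k ∈ inferior θ, (best θ - mean θ k) *
        ∑ s ∈ Finset.Ico 1 N, (highEvent B x k s).indicator 1 ω := by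
    intro ω
    have h1 : ∀ k, (best θ - mean θ k) * max ((count (history π ω N) k : ℝ) - 1) 0 ≤
        (∑ n ∈ Finset.Ico K N, if π.act n (history π ω n) = k then
          D * (lowEvent (b n) x l n).indicator 1 ω else 0) +
        (best θ - mean θ k) * ∑ s ∈ Finset.Ico 1 N, (highEvent B x k s).indicator 1 ω := by
      intro k
      refine (mul_le_mul_of_nonneg_left (count_sub_one_le π ω hπ x k l N hb) (hgap k)).trans ?_
      rw [mul_add, Finset.mul_sum]
      refine add_le_add (Finset.sum_le_sum fun n _ => ?_)
        (mul_le_mul_of_nonneg_left ?_ (hgap k))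
      · split_ifs
        · exact mul_le_mul_of_nonneg_right (hD k) (hind _ ω)
        · rw [mul_zero]
      · refine Finset.sum_le_sum_of_subset_of_nonneg ?_ fun _ _ _ => hind _ ω
        exact Finset.Ico_subset_Ico le_rfl (count_le π ω N k)
    refine (Finset.sum_le_sum fun k _ => h1 k).trans (le_of_eq ?_)
    rw [Finset.sum_add_distrib, Finset.sum_comm]
    congr 1
    · simp [Finset.mul_sum]
    · refine (Finset.sum_subset (Finset.subset_univ _) fun k _ hk => ?_).symm
      have : mean θ k = best θ := by
        refine le_antisymm (mean_le_best θ k) (not_lt.1 fun h => hk ?_)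
        simpa [inferior] using h
      rw [this, sub_self, zero_mul]
  have hint : ∀ S : Set (Fin K × ℕ → ℝ), MeasurableSet S →
      Integrable (S.indicator (1 : (Fin K × ℕ → ℝ) → ℝ)) (rewardLaw θ) :=
    fun S hS => (integrable_const (1 : ℝ)).indicator hS
  have hlow := fun n => hint _ (measurableSet_lowEvent (b n) x l n)
  have hhigh := fun k s => hint _ (measurableSet_highEvent B x k s)
  have hI1 : Integrable (fun ω => D * ∑ n ∈ Finset.Ico K N,
      (lowEvent (b n) x l n).indicator (1 : (Fin K × ℕ → ℝ) → ℝ) ω) (rewardLaw θ) :=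
    (integrable_finsetSum _ fun n _ => hlow n).const_mul D
  have hI2 : ∀ k, Integrable (fun ω => ∑ s ∈ Finset.Ico 1 N,
      (highEvent B x k s).indicator (1 : (Fin K × ℕ → ℝ) → ℝ) ω) (rewardLaw θ) :=
    fun k => integrable_finsetSum _ fun s _ => hhigh k s
  have hI3 : Integrable (fun ω => ∑ k ∈ inferior θ, (best θ - mean θ k) *
      ∑ s ∈ Finset.Ico 1 N, (highEvent B x k s).indicator (1 : (Fin K × ℕ → ℝ) → ℝ) ω)
      (rewardLaw θ) := integrable_finsetSum _ fun k _ => (hI2 k).const_mul _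
  have hleft : tildeRegret π θ N = ∫ ω, ∑ k, (best θ - mean θ k) *
      max ((count (history π ω N) k : ℝ) - 1) 0 ∂(rewardLaw θ) := by
    rw [integral_finsetSum _ fun k _ => (integrable_max_count π N k).const_mul _]
    simp_rw [integral_const_mul]
    rfl
  rw [hleft]
  refine (integral_mono (integrable_finsetSum _ fun k _ =>
    (integrable_max_count π N k).const_mul _) (hI1.add hI3) hpt).trans (le_of_eq ?_)
  rw [integral_add' hI1 hI3, integral_const_mul, integral_finsetSum _ fun n _ => hlow n,
    integral_finsetSum _ fun k _ => (hI2 k).const_mul _]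
  congr 1
  · congr 1
    exact Finset.sum_congr rfl fun n _ => integral_indicator_one (measurableSet_lowEvent _ _ _ _)
  · refine Finset.sum_congr rfl fun k _ => ?_
    rw [integral_const_mul, integral_finsetSum _ fun s _ => hhigh k s]
    congr 1
    exact Finset.sum_congr rfl fun s _ => integral_indicator_one (measurableSet_highEvent _ _ _ _)

theorem gap_le {Δ : ℝ} (hθ : θ ∈ Theta2 K Δ) (k : Fin K) : best θ - mean θ k ≤ 2 / Δ := by
  have : Nonempty (Fin K) := ⟨k⟩
  obtain ⟨l, hl⟩ : ∃ l, mean θ l = best θ := exists_eq_ciSup_of_finite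
  have h1 := (abs_le.1 (hθ.2.1 k)).1
  have h2 := (abs_le.1 (hθ.2.1 l)).2
  rw [hl] at h2
  rw [div_eq_mul_inv]
  linarith

theorem mul_pow_le_r {Δ : ℝ} (hΔ : 0 < Δ) (hθ : θ ∈ Theta2 K Δ) : Δ ^ 4 * K ≤ r θ := by
  have ⟨_, _, hsd, hcard⟩ := hθ
  have hterm : ∀ k ∈ inferior θ,
      Δ ^ 3 ≤ (best θ - mean θ k) / M ((best θ - mean θ k) / sd θ k) := by
    intro k hk
    have hk' : mean θ k < best θ := by simpa [inferior] using hk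
    have hσ : 0 < sd θ k := hΔ.trans_le (hsd k).1
    have hd : 0 < best θ - mean θ k := sub_pos.2 hk'
    have hd2 := gap_le hθ k
    set d := best θ - mean θ k
    rw [le_div_iff₀ (M_pos (div_pos hd hσ))]
    calc Δ ^ 3 * M (d / sd θ k) ≤ Δ ^ 3 * ((d / sd θ k) ^ 2 / 2) :=
          mul_le_mul_of_nonneg_left (M_le_half_sq _) (by positivity)
      _ = d * (d * (Δ ^ 3 / (2 * sd θ k ^ 2))) := by field_simp
      _ ≤ d * (2 / Δ * (Δ ^ 3 / (2 * Δ ^ 2))) := by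
          have := (hsd k).1
          gcongr
      _ = d := by field_simp
  calc Δ ^ 4 * K = (Δ * K) * Δ ^ 3 := by ring
    _ ≤ (inferior θ).card * Δ ^ 3 := mul_le_mul_of_nonneg_right hcard (by positivity)
    _ ≤ r θ := by
        rw [r, ← nsmul_eq_mul]
        exact Finset.card_nsmul_le_sum _ _ _ hterm

/-- A uniform bound for the ratio of the regret to `r(θ) log N` over `Θ₂(Δ)`: a contribution
of the low confidence bounds of the optimal arm, and the main term `B / log N` up to the factor
`slack ε`, where `B` bounds the confidence coefficients. -/
theorem worstRatio_le {b : ℕ → ℝ} {π : Policy K} (hπ : IsUCB b π) {Δ ε B : ℝ} (hΔ : 0 < Δ)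
    (hε : 0 < ε) (hε' : ε < 1 / 2) (hB : 0 ≤ B) {N : ℕ} (hN : 1 < N)
    (hb : ∀ n, K ≤ n → n < N → b n ≤ B) :
    worstRatio π Δ N ≤ ((256 / ε ^ 4 * ((∑ n ∈ Finset.Ico K N, Real.exp (-b n)) /
        (Δ ^ 13 * K * Real.log N)) +
      (B / slack ε + 1 / ε ^ 2 + (1 + 1 / varRate ε) * (1 / 2 * Real.log (1 + 4 / Δ ^ 4))) /
        Real.log N : ℝ) : EReal) := by
  refine iSup₂_le fun θ hθ => EReal.coe_le_coe_iff.2 ?_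
  have hK : Nonempty (Fin K) := ⟨π.act 0 Fin.elim0⟩
  have hK0 : (0 : ℝ) < K := by exact_mod_cast Fin.pos_iff_nonempty.2 hK
  have hlog : 0 < Real.log N := Real.log_pos (by exact_mod_cast hN)
  have hr := mul_pow_le_r hΔ hθ
  have hr0 : 0 < r θ := lt_of_lt_of_le (by positivity) hr
  have ⟨hgap, _, hsd, _⟩ := hθ
  obtain ⟨l, hl⟩ : ∃ l, mean θ l = best θ := exists_eq_ciSup_of_finite
  have hσ : ∀ k, 0 < sd θ k := fun k => hΔ.trans_le (hsd k).1
  have hD := gap_le hθ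
  have hc0 := slack_pos hε hε'
  have hκ := varRate_pos hε
  have hδ : 0 < ε * Δ := mul_pos hε hΔ
  set S := ∑ n ∈ Finset.Ico K N, Real.exp (-b n) with hS
  have hS0 : 0 ≤ S := Finset.sum_nonneg fun _ _ => (Real.exp_pos _).le
  set L := 1 / 2 * Real.log (1 + 4 / Δ ^ 4) with hL
  set A := B / slack ε + 1 / ε ^ 2 + (1 + 1 / varRate ε) * L with hA
  have h1 := tildeRegret_le_sum_measureReal hπ θ (best θ - ε * Δ) l N hb hD
  have hlow : ∑ n ∈ Finset.Ico K N,
      (rewardLaw θ).real (lowEvent (b n) (best θ - ε * Δ) l n) ≤ 128 / (ε ^ 4 * Δ ^ 8) * S := by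
    rw [hS, Finset.mul_sum]
    refine Finset.sum_le_sum fun n _ => ?_
    have h2 := measureReal_lowEvent_le (hσ l) (b n) hδ n
    rw [hl] at h2
    refine h2.trans (mul_le_mul_of_nonneg_right ?_ (Real.exp_pos _).le)
    have h3 : sd θ l / (ε * Δ) ≤ Δ⁻¹ / (ε * Δ) := div_le_div_of_nonneg_right (hsd l).2 hδ.le
    calc 128 * (sd θ l / (ε * Δ)) ^ 4 ≤ 128 * (Δ⁻¹ / (ε * Δ)) ^ 4 := by
          have := (hσ l).le
          gcongr
      _ = _ := by field_simp
  have hhigh : ∑ k ∈ inferior θ, (best θ - mean θ k) * ∑ s ∈ Finset.Ico 1 N,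
      (rewardLaw θ).real (highEvent B (best θ - ε * Δ) k s) ≤ r θ * A := by
    rw [r, Finset.sum_mul]
    refine Finset.sum_le_sum fun k hk => ?_
    have hk' : mean θ k < best θ := by simpa [inferior] using hk
    have hd : 0 < best θ - mean θ k := sub_pos.2 hk'
    have hdΔ : Δ ≤ best θ - mean θ k := by linarith [hgap k hk']
    have h2 := sum_measureReal_highEvent_le (hσ k) (B := B) (x := best θ - ε * Δ) hε hε' hd hB
      (by nlinarith) N
    set z := (best θ - mean θ k) / sd θ k with hz
    have hM := M_pos (div_pos hd (hσ k))
    have hML : M z ≤ L := by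
      rw [M, hL]
      have h3 : z ≤ (2 / Δ) / Δ :=
        div_le_div₀ (by positivity) (hD k) hΔ (hsd k).1
      have h4 : z ^ 2 ≤ ((2 / Δ) / Δ) ^ 2 := pow_le_pow_left₀ (div_pos hd (hσ k)).le h3 2
      have h5 : ((2 / Δ) / Δ) ^ 2 = 4 / Δ ^ 4 := by field_simp; norm_num
      rw [h5] at h4
      have := Real.log_le_log (by positivity) (show 1 + z ^ 2 ≤ 1 + 4 / Δ ^ 4 by linarith)
      linarith
    have h6 : (B / slack ε + 1 / ε ^ 2 + (1 + 1 / varRate ε) * M z) / M z ≤ A / M z := by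
      rw [hA]
      gcongr
    calc _ ≤ (best θ - mean θ k) * (A / M z) :=
          mul_le_mul_of_nonneg_left (h2.trans h6) hd.le
      _ = _ := by ring
  have h2 : tildeRegret π θ N ≤ 256 / (ε ^ 4 * Δ ^ 9) * S + r θ * A := by
    have h3 := mul_le_mul_of_nonneg_left hlow (show 0 ≤ 2 / Δ by positivity)
    have h4 : 2 / Δ * (128 / (ε ^ 4 * Δ ^ 8) * S) = 256 / (ε ^ 4 * Δ ^ 9) * S := by
      field_simp; ring
    rw [h4] at h3
    linarith
  calc tildeRegret π θ N / (r θ * Real.log N)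
      ≤ (256 / (ε ^ 4 * Δ ^ 9) * S + r θ * A) / (r θ * Real.log N) :=
        div_le_div_of_nonneg_right h2 (by positivity)
    _ = 256 / (ε ^ 4 * Δ ^ 9) * S / (r θ * Real.log N) + A / Real.log N := by field_simp
    _ ≤ 256 / (ε ^ 4 * Δ ^ 9) * S / (Δ ^ 4 * K * Real.log N) + A / Real.log N := by gcongr
    _ = _ := by field_simp

end

/-! ### Asymptotics -/

theorem tendsto_log_natCast_atTop : Tendsto (fun N : ℕ => Real.log N) atTop atTop :=
  Real.tendsto_log_atTop.comp tendsto_natCast_atTop_atTop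

/-- The relative error `ε` in the bounds is arbitrary, and `slack ε → 1` as `ε → 0`. -/
theorem limsup_le_of_tendsto_div_slack {f : ℕ → EReal} {L : ℝ} {G : ℝ → ℕ → ℝ}
    (h : ∀ ε, 0 < ε → ε < 1 / 2 → ∀ᶠ N in atTop, f N ≤ (G ε N : EReal))
    (hG : ∀ ε, 0 < ε → ε < 1 / 2 → Tendsto (G ε) atTop (𝓝 (L / slack ε))) :
    limsup f atTop ≤ (L : EReal) := by
  refine (EReal.le_of_forall_lt_iff_le).1 fun x hx => ?_
  have hx' : L < x := by exact_mod_cast hx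
  have h1 : Tendsto (fun ε => L / slack ε) (𝓝[>] 0) (𝓝 L) := by
    have h2 : ContinuousAt (fun ε => L / slack ε) 0 := by
      unfold slack
      refine ContinuousAt.div (by fun_prop) (ContinuousAt.div (by fun_prop) (by fun_prop) ?_) ?_ <;>
      norm_num
    have h3 := h2.tendsto.mono_left (nhdsWithin_le_nhds (s := Set.Ioi 0))
    simpa [slack] using h3
  have h4 : ∀ᶠ ε : ℝ in 𝓝[>] 0, 0 < ε ∧ ε < 1 / 2 ∧ L / slack ε < x := by
    filter_upwards [Ioo_mem_nhdsGT (show (0 : ℝ) < 1 / 2 by norm_num), h1.eventually_lt_const hx']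
      with ε h5 h6
    exact ⟨h5.1, h5.2, h6⟩
  obtain ⟨ε, h5, h6, h7⟩ := h4.exists
  refine limsup_le_of_le (by isBoundedDefault) ?_
  filter_upwards [h ε h5 h6, (hG ε h5 h6).eventually_lt_const h7] with N h8 h9
  exact h8.trans (by exact_mod_cast h9.le)

/-- The common part of both regimes: three scalar limits that give the bound
`lim b_N / log N`, where `B N` is the largest confidence coefficient in use before `N`. -/
theorem limsup_worstRatio_le {K : ℕ → ℕ} {Δ : ℕ → ℝ} (hΔ : ∀ N, 0 < Δ N) {b : ℕ → ℕ → ℝ}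
    {π : (N : ℕ) → Policy (K N)} (hπ : ∀ N, IsUCB (b N) (π N)) {B : ℕ → ℝ} {L : ℝ}
    (hB : ∀ᶠ N in atTop, 0 ≤ B N)
    (hb : ∀ᶠ N in atTop, ∀ n, K N ≤ n → n < N → b N n ≤ B N)
    (hBL : Tendsto (fun N : ℕ => B N / Real.log N) atTop (𝓝 L))
    (hsum : Tendsto (fun N : ℕ => (∑ n ∈ Finset.Ico (K N) N, Real.exp (-b N n)) /
      (Δ N ^ 13 * K N * Real.log N)) atTop (𝓝 0))
    (hM : Tendsto (fun N : ℕ => Real.log (1 + 4 / Δ N ^ 4) / Real.log N) atTop (𝓝 0)) :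
    limsup (fun N => worstRatio (π N) (Δ N) N) atTop ≤ (L : EReal) := by
  refine limsup_le_of_tendsto_div_slack (G := fun ε N =>
      256 / ε ^ 4 * ((∑ n ∈ Finset.Ico (K N) N, Real.exp (-b N n)) /
        (Δ N ^ 13 * K N * Real.log N)) +
      (B N / slack ε + 1 / ε ^ 2 + (1 + 1 / varRate ε) * (1 / 2 * Real.log (1 + 4 / Δ N ^ 4))) /
        Real.log N) (fun ε hε hε' => ?_) fun ε hε hε' => ?_
  · filter_upwards [hB, hb, eventually_gt_atTop 1] with N h1 h2 h3
    exact worstRatio_le (hπ N) (hΔ N) hε hε' h1 h3 h2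
  · have h1 : Tendsto (fun N : ℕ => (Real.log N)⁻¹) atTop (𝓝 0) :=
      tendsto_inv_atTop_zero.comp tendsto_log_natCast_atTop
    have h2 := ((hsum.const_mul (256 / ε ^ 4)).add (hBL.div_const (slack ε))).add
      ((h1.const_mul (1 / ε ^ 2)).add (hM.const_mul ((1 + 1 / varRate ε) * (1 / 2))))
    simp only [mul_zero, zero_add, add_zero] at h2
    refine h2.congr fun N => ?_
    ring

theorem sum_inv_le {K N : ℕ} (hK : 1 ≤ K) :
    ∑ n ∈ Finset.Ico K N, (n : ℝ)⁻¹ ≤ 1 + Real.log N := by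
  have h1 := harmonic_le_one_add_log N
  rw [harmonic_eq_sum_Icc] at h1
  push_cast at h1
  refine le_trans (Finset.sum_le_sum_of_subset_of_nonneg ?_ fun _ _ _ => by positivity) h1
  intro n hn
  rw [Finset.mem_Ico] at hn
  exact Finset.mem_Icc.2 ⟨by omega, by omega⟩

/-! ### A growing number of arms -/

theorem ArmGrowth.tendsto_atTop {K : ℕ → ℕ} {ζ : ℝ} (hζ : 0 < ζ) (hK : ArmGrowth K ζ) :
    Tendsto K atTop atTop := by
  obtain ⟨e, he, hKe⟩ := hK
  rw [← tendsto_natCast_atTop_iff (R := ℝ)]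
  refine tendsto_atTop_mono' _ ?_
    ((tendsto_rpow_atTop (half_pos hζ)).comp tendsto_natCast_atTop_atTop)
  filter_upwards [hKe, he.eventually_const_lt (show -(ζ / 2) < 0 by linarith),
    eventually_ge_atTop 1] with N h1 h2 h3
  rw [h1]
  exact Real.rpow_le_rpow_of_exponent_le (by exact_mod_cast h3) (by linarith)

theorem ArmGrowth.eventually_le {K : ℕ → ℕ} {ζ : ℝ} (hζ : ζ < 1) (hK : ArmGrowth K ζ) :
    ∀ᶠ N in atTop, K N ≤ N := by
  obtain ⟨e, he, hKe⟩ := hK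
  filter_upwards [hKe, he.eventually_lt_const (show 0 < 1 - ζ by linarith),
    eventually_ge_atTop 1] with N h1 h2 h3
  have h4 : (K N : ℝ) ≤ (N : ℝ) ^ (1 : ℝ) := by
    rw [h1]
    exact Real.rpow_le_rpow_of_exponent_le (by exact_mod_cast h3) (by linarith)
  rw [Real.rpow_one] at h4
  exact_mod_cast h4

theorem ArmGrowth.tendsto_log_div_log {K : ℕ → ℕ} {ζ : ℝ} (hK : ArmGrowth K ζ) :
    Tendsto (fun N : ℕ => Real.log (K N) / Real.log N) atTop (𝓝 ζ) := by
  obtain ⟨e, he, hKe⟩ := hK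
  have h1 : Tendsto (fun N => ζ + e N) atTop (𝓝 ζ) := by simpa using he.const_add ζ
  refine h1.congr' ?_
  filter_upwards [hKe, eventually_gt_atTop 1] with N h2 h3
  have h4 : 0 < Real.log N := Real.log_pos (by exact_mod_cast h3)
  rw [h2, Real.log_rpow (by positivity), mul_div_cancel_right₀ _ h4.ne']

/-- `1 / Δ_K` is at most `K ^ η ≤ N ^ η` eventually for each `η > 0`, so its logarithm is
negligible against `log N`. -/
theorem SubPolynomial.tendsto_log_div_log {Δ : ℕ → ℝ} (hΔ : SubPolynomial Δ) {K : ℕ → ℕ}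
    (hK : Tendsto K atTop atTop) (hKN : ∀ᶠ N in atTop, K N ≤ N) :
    Tendsto (fun N : ℕ => Real.log (1 + 4 / Δ (K N) ^ 4) / Real.log N) atTop (𝓝 0) := by
  have hnonneg : ∀ N : ℕ, 0 ≤ Real.log (1 + 4 / Δ (K N) ^ 4) / Real.log N := by
    intro N
    have := hΔ.pos (K N)
    exact div_nonneg (Real.log_nonneg (by linarith [show 0 < 4 / Δ (K N) ^ 4 by positivity]))
      (Real.log_natCast_nonneg N)
  refine tendsto_order.2 ⟨fun a ha => Eventually.of_forall fun N => ha.trans_le (hnonneg N),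
    fun a ha => ?_⟩
  have h1 : Tendsto (fun N : ℕ => Real.log 5 / Real.log N) atTop (𝓝 0) :=
    tendsto_const_nhds.div_atTop tendsto_log_natCast_atTop
  filter_upwards [hKN, (hΔ.tendsto_zero.comp hK).eventually_lt_const one_pos,
    ((hΔ.rate (a / 8) (by positivity)).comp hK).eventually_ge_atTop 1,
    h1.eventually_lt_const (half_pos ha), eventually_gt_atTop 1,
    hK.eventually_ge_atTop 1] with N h2 h3 h4 h5 h6 h7
  simp only [Function.comp] at h3 h4
  have hpos := hΔ.pos (K N)
  have hN : (0 : ℝ) < N := by positivity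
  have hlog : 0 < Real.log N := Real.log_pos (by exact_mod_cast h6)
  have hinv : 1 / Δ (K N) ≤ (N : ℝ) ^ (a / 8) := by
    rw [div_le_iff₀ hpos, mul_comm]
    refine h4.trans (mul_le_mul_of_nonneg_left ?_ hpos.le)
    exact Real.rpow_le_rpow (by positivity) (by exact_mod_cast h2) (by positivity)
  have h8 : 1 + 4 / Δ (K N) ^ 4 ≤ 5 * ((N : ℝ) ^ (a / 8)) ^ 4 := by
    have h9 : (1 / Δ (K N)) ^ 4 ≤ ((N : ℝ) ^ (a / 8)) ^ 4 := pow_le_pow_left₀ (by positivity) hinv 4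
    have h10 : 1 ≤ (1 / Δ (K N)) ^ 4 :=
      one_le_pow₀ ((one_le_div hpos).2 h3.le)
    have h11 : 4 / Δ (K N) ^ 4 = 4 * (1 / Δ (K N)) ^ 4 := by rw [one_div, inv_pow]; ring
    rw [h11]
    linarith
  have h12 := Real.log_le_log (by positivity) h8
  rw [Real.log_mul (by norm_num) (by positivity), Real.log_pow, Real.log_rpow hN] at h12
  rw [div_lt_iff₀ hlog] at h5 ⊢
  push_cast at h12
  linarith

/-- Here `exp (-b_n) = K ^ (1 - q) / n`, and summing over `n` costs a factor `log N`. This leaves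
`K ^ (-q)` against powers of `1 / Δ_K`, which grow more slowly than any power of `K`. -/
theorem limsup_worstRatio_coeffLarge_le {Δ : ℕ → ℝ} (hΔ : SubPolynomial Δ) {ζ q : ℝ} (hζ : 0 < ζ)
    (hζ' : ζ < 1) (hq : 0 < q) {K : ℕ → ℕ} (hK : ArmGrowth K ζ) {π : (N : ℕ) → Policy (K N)}
    (hπ : ∀ N, IsUCB (coeffLarge q (K N)) (π N)) :
    limsup (fun N : ℕ => worstRatio (π N) (Δ (K N)) N) atTop
      ≤ ((1 - ζ + ζ * q : ℝ) : EReal) := by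
  have hKtop := hK.tendsto_atTop hζ
  have hKN := hK.eventually_le hζ'
  have hcoeff : ∀ N n : ℕ, 1 ≤ K N → 1 ≤ n →
      coeffLarge q (K N) n = Real.log n - (1 - q) * Real.log (K N) := by
    intro N n h1 h2
    rw [coeffLarge, Real.log_div (by positivity) (by positivity), Real.log_rpow (by positivity)]
  refine limsup_worstRatio_le (fun N => hΔ.pos (K N)) hπ
    (B := fun N => coeffLarge q (K N) N) ?_ ?_ ?_ ?_ (hΔ.tendsto_log_div_log hKtop hKN)
  · filter_upwards [hKN, hKtop.eventually_ge_atTop 1] with N h1 h2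
    rw [hcoeff N N h2 (h2.trans h1)]
    have h3 : Real.log (K N) ≤ Real.log N :=
      Real.log_le_log (by positivity) (by exact_mod_cast h1)
    have h4 := mul_nonneg hq.le (Real.log_natCast_nonneg (K N))
    linarith
  · filter_upwards [hKtop.eventually_ge_atTop 1] with N h1 n h2 h3
    rw [hcoeff N n h1 (h1.trans h2), hcoeff N N h1 (by omega)]
    have h4 : Real.log n ≤ Real.log N :=
      Real.log_le_log (by exact_mod_cast h1.trans h2) (by exact_mod_cast h3.le)
    linarith
  · have h1 := (hK.tendsto_log_div_log.const_mul (1 - q)).const_sub 1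
    have h2 : 1 - (1 - q) * ζ = 1 - ζ + ζ * q := by ring
    rw [h2] at h1
    refine h1.congr' ?_
    filter_upwards [hKtop.eventually_ge_atTop 1, eventually_gt_atTop 1] with N h3 h4
    have h5 : 0 < Real.log N := Real.log_pos (by exact_mod_cast h4)
    rw [hcoeff N N h3 h4.le]
    field_simp
  · have h1 : Tendsto (fun N : ℕ => (Real.log N)⁻¹ + 1) atTop (𝓝 (0 + 1)) :=
      (tendsto_inv_atTop_zero.comp tendsto_log_natCast_atTop).add_const 1
    -- `Δ ^ 13 K ^ q` is the thirteenth power of `Δ K ^ (q / 13)`, which tends to infinity.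
    have h2 : Tendsto (fun N => ((Δ (K N) * (K N : ℝ) ^ (q / 13)) ^ 13)⁻¹) atTop (𝓝 0) :=
      tendsto_inv_atTop_zero.comp ((tendsto_pow_atTop (by norm_num)).comp
        ((hΔ.rate (q / 13) (by positivity)).comp hKtop))
    have h3 := h2.mul h1
    rw [zero_mul] at h3
    refine squeeze_zero' (Eventually.of_forall fun N => ?_) ?_ h3
    · have := (hΔ.pos (K N)).le
      have := Real.log_natCast_nonneg N
      positivity
    · filter_upwards [hKtop.eventually_ge_atTop 1, eventually_gt_atTop 1] with N h4 h5
      have hpos := hΔ.pos (K N)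
      have hK0 : (0 : ℝ) < K N := by exact_mod_cast h4
      have hlog : 0 < Real.log N := Real.log_pos (by exact_mod_cast h5)
      have h6 : ∑ n ∈ Finset.Ico (K N) N, Real.exp (-coeffLarge q (K N) n) ≤
          (K N : ℝ) ^ (1 - q) * (1 + Real.log N) := by
        refine le_trans (le_of_eq ?_)
          (mul_le_mul_of_nonneg_left (sum_inv_le (N := N) h4) (by positivity))
        rw [Finset.mul_sum]
        refine Finset.sum_congr rfl fun n hn => ?_
        have hn1 := (Finset.mem_Ico.1 hn).1
        have hn0 : (0 : ℝ) < n := by exact_mod_cast (show 0 < n by omega)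
        rw [coeffLarge, Real.exp_neg, Real.exp_log (by positivity), inv_div, div_eq_mul_inv]
      have h7 : (K N : ℝ) ^ (1 - q) = K N * ((((K N : ℝ) ^ (q / 13)) ^ 13))⁻¹ := by
        rw [← Real.rpow_mul_natCast hK0.le, Real.rpow_sub hK0, Real.rpow_one]
        push_cast
        rw [div_mul_cancel₀ _ (by norm_num), div_eq_mul_inv]
      rw [h7] at h6
      refine (div_le_div_of_nonneg_right h6 (by positivity)).trans (le_of_eq ?_)
      have : ((K N : ℝ) ^ (q / 13)) ≠ 0 := by positivity
      field_simp

/-! ### A fixed number of arms -/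

theorem monotone_bFixed {α x y : ℝ} (hα : 0 ≤ α) (hx : 1 ≤ x) (hxy : x ≤ y) :
    bFixed α x ≤ bFixed α y := by
  have h1 : Real.log x ≤ Real.log y := Real.log_le_log (by linarith) hxy
  have h2 : 0 ≤ Real.log x := Real.log_nonneg hx
  have h3 : Real.log (1 + Real.log x) ≤ Real.log (1 + Real.log y) :=
    Real.log_le_log (by linarith) (by linarith)
  unfold bFixed
  nlinarith

theorem tendsto_add_log_div_add (α c : ℝ) :
    Tendsto (fun u : ℝ => (u + α * Real.log (1 + u)) / (u + c)) atTop (𝓝 1) := by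
  have h1 : Tendsto (fun u : ℝ => 1 + u) atTop atTop := tendsto_atTop_add_const_left _ 1 tendsto_id
  have h2 : Tendsto (fun u : ℝ => u + c) atTop atTop := tendsto_atTop_add_const_right _ c tendsto_id
  have h3 : Tendsto (fun u : ℝ => Real.log (1 + u) / (1 + u)) atTop (𝓝 0) :=
    Real.isLittleO_log_id_atTop.tendsto_div_nhds_zero.comp h1
  have h4 : ∀ a : ℝ, Tendsto (fun u : ℝ => 1 + (a - c) / (u + c)) atTop (𝓝 1) := by
    intro a
    simpa using (tendsto_const_nhds (x := a - c)).div_atTop h2 |>.const_add 1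
  have h5 := (h4 0).add ((h3.mul (h4 1)).const_mul α)
  simp only [zero_mul, mul_zero, add_zero] at h5
  refine h5.congr' ?_
  filter_upwards [h1.eventually_gt_atTop 0, h2.eventually_gt_atTop 0] with u h6 h7
  field_simp
  ring

/-- With `K` and `Δ` fixed it suffices that `∑ exp (-b_n) = o(log N)`, which holds because
`n exp (-b_n) → 0`. -/
theorem limsup_worstRatio_coeffFixed_le {Δ : ℝ} (hΔ : 0 < Δ) {K : ℕ} {α : ℝ} (hα : 1 < α)
    {π : (N : ℕ) → Policy K} (hπ : ∀ N, IsUCB (coeffFixed α K) (π N)) :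
    limsup (fun N : ℕ => worstRatio (π N) Δ N) atTop ≤ ((1 : ℝ) : EReal) := by
  have hK : 0 < K := Fin.pos_iff_nonempty.2 ⟨(π 0).act 0 Fin.elim0⟩
  have hK0 : (0 : ℝ) < K := by exact_mod_cast hK
  have hα0 : 0 < α := by linarith
  have hu : Tendsto (fun N : ℕ => Real.log ((N : ℝ) / K)) atTop atTop :=
    Real.tendsto_log_atTop.comp (tendsto_natCast_atTop_atTop.atTop_div_const hK0)
  have hratio : ∀ n : ℕ, K ≤ n → 1 ≤ (n : ℝ) / K := by
    intro n hn
    rw [one_le_div hK0]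
    exact_mod_cast hn
  refine limsup_worstRatio_le (fun _ => hΔ) hπ (B := fun N => coeffFixed α K N) ?_ ?_ ?_ ?_
    (tendsto_const_nhds.div_atTop tendsto_log_natCast_atTop)
  · filter_upwards [eventually_ge_atTop K] with N hN
    have h1 := monotone_bFixed hα0.le le_rfl (hratio N hN)
    simpa [bFixed, coeffFixed] using h1
  · refine Eventually.of_forall fun N n h1 h2 => monotone_bFixed hα0.le (hratio n h1) ?_
    exact div_le_div_of_nonneg_right (by exact_mod_cast h2.le) hK0.le
  · refine ((tendsto_add_log_div_add α (Real.log K)).comp hu).congr' ?_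
    filter_upwards [eventually_ge_atTop 1] with N hN
    have hN0 : (N : ℝ) ≠ 0 := by positivity
    simp only [Function.comp, coeffFixed, bFixed]
    congr 1
    rw [Real.log_div hN0 hK0.ne', sub_add_cancel]
  · -- The summands are `o(1 / n)`, so their sum is `o(log N)`.
    have h1 : Tendsto (fun n : ℕ => Real.exp (-coeffFixed α K n) / (1 / ((n : ℝ) + 1))) atTop
        (𝓝 0) := by
      have h2 : Tendsto (fun n : ℕ => Real.exp (-(α * Real.log (1 + Real.log ((n : ℝ) / K)))))
          atTop (𝓝 0) :=
        Real.tendsto_exp_neg_atTop_nhds_zero.comp ((Real.tendsto_log_atTop.comp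
          (tendsto_atTop_add_const_left _ 1 hu)).const_mul_atTop hα0)
      have h3 : Tendsto (fun n : ℕ => (n : ℝ)⁻¹) atTop (𝓝 0) := tendsto_inv_atTop_nhds_zero_nat
      have h4 := (h2.mul (h3.const_add 1)).const_mul (K : ℝ)
      simp only [zero_mul, mul_zero] at h4
      refine h4.congr' ?_
      filter_upwards [eventually_ge_atTop 1] with n hn
      have hn0 : (0 : ℝ) < n := by exact_mod_cast hn
      rw [coeffFixed, bFixed, neg_add, Real.exp_add, Real.exp_neg (Real.log ((n : ℝ) / K)),
        Real.exp_log (by positivity)]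
      field_simp
    have h2 : (fun n : ℕ => Real.exp (-coeffFixed α K n)) =o[atTop]
        fun n : ℕ => 1 / ((n : ℝ) + 1) :=
      (Asymptotics.isLittleO_iff_tendsto fun n hn => absurd hn (by positivity)).2 h1
    have h3 := h2.sum_range (fun n => by positivity) Real.tendsto_sum_range_one_div_nat_succ_atTop
    have h4 : (fun N : ℕ => ∑ n ∈ Finset.range N, 1 / ((n : ℝ) + 1)) =O[atTop]
        fun N : ℕ => Real.log N := by
      refine Asymptotics.IsBigO.of_bound 2 ?_
      filter_upwards [tendsto_log_natCast_atTop.eventually_ge_atTop 1] with N hN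
      have h5 := harmonic_le_one_add_log N
      rw [harmonic] at h5
      push_cast at h5
      have h6 : 0 ≤ ∑ n ∈ Finset.range N, 1 / ((n : ℝ) + 1) :=
        Finset.sum_nonneg fun _ _ => by positivity
      rw [Real.norm_of_nonneg h6, Real.norm_of_nonneg (by linarith)]
      simp only [one_div]
      linarith
    have h5 := (h3.trans_isBigO h4).tendsto_div_nhds_zero.div_const (Δ ^ 13 * K)
    rw [zero_div] at h5
    refine squeeze_zero (fun N => ?_) (fun N => ?_) h5
    · have := Real.log_natCast_nonneg N
      positivity
    · rw [div_div, mul_comm (Real.log (N : ℝ))]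
      refine div_le_div_of_nonneg_right ?_ (mul_nonneg (by positivity) (Real.log_natCast_nonneg N))
      refine Finset.sum_le_sum_of_subset_of_nonneg ?_ fun _ _ _ => (Real.exp_pos _).le
      intro n hn
      exact Finset.mem_range.2 (Finset.mem_Ico.1 hn).2

end UCBLarge

end

open UCBLarge in
theorem theorem4 (Δ : ℕ → ℝ) (hΔ : SubPolynomial Δ) :
    -- the number of arms grows with the sample size
    (∀ (ζ : ℝ), 0 < ζ → ζ < 1 → ∀ (q : ℝ), 0 < q →
      ∀ (K : ℕ → ℕ), ArmGrowth K ζ →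
      ∀ (π : (N : ℕ) → Policy (K N)), (∀ N, IsUCB (coeffLarge q (K N)) (π N)) →
        limsup (fun N : ℕ => worstRatio (π N) (Δ (K N)) N) atTop
          ≤ ((1 - ζ + ζ * q : ℝ) : EReal)) ∧
    -- the number of arms is fixed, that is, `ζ = 0`
    (∀ (K : ℕ) (α : ℝ), 1 < α →
      ∀ (π : (N : ℕ) → Policy K), (∀ N, IsUCB (coeffFixed α K) (π N)) →
        limsup (fun N : ℕ => worstRatio (π N) (Δ K) N) atTop ≤ ((1 : ℝ) : EReal)) :=
  ⟨fun _ hζ hζ' _ hq _ hK _ hπ => limsup_worstRatio_coeffLarge_le hΔ hζ hζ' hq hK hπ,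
    fun K _ hα _ hπ => limsup_worstRatio_coeffFixed_le (hΔ.pos K) hα hπ⟩
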